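/- Let $(X,L)$ be a polarized normal projective variety over $\mathbb C$, let $r>0$ be such that $L^r$ is very ample, put $V=H^0(X,L^r)$, and embed $X\subset P(V)$ by the sections of $L^r$ (so the elements of $V$ are the linear forms on $P(V)$, and $\mathcal O(1)|_X=L^r$). Let $I\subset \mathrm{Sym}\,V$ be the homogeneous ideal of $X$. Let $\mathbf G_0$ be a reductive group acting on $(X,L)$, hence linearly on $V$, preserving $I$. (Reductivity is not needed; the statement holds for any group acting linearly on $V$ and preserving $X$, and for any normal closed subvariety $X$ of $P(V)$ with $L^r=\mathcal O(1)|_X$.) A real 1-PS is a family $\sigma(t)=\mathrm{diag}(e^{-\lambda_1t},\dots,e^{-\lambda_nt})$, $t\in\mathbb R$, in $GL(V)$ with respect to some basis $x_1,\dots,x_n$ of $V$; the $\lambda_i\in\mathbb R$ are its eigenvalues. It is $\mathbf G_0$-equivariant if every $\sigma(t)$ commutes with $\mathbf G_0$. For $f=\sum_\alpha c_\alpha x^\alpha\in\mathrm{Sym}\,V=\mathbb C[x_1,\dots,x_n]$ let $Lt(f)$ be the sum of those terms $c_\alpha x^\alpha$ with $c_\alpha\ne0$ for which $\langle\alpha,\lambda\rangle=\sum\alpha_i\lambda_i$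 is minimal. The central fiber $\mathcal X_0^\sigma=\lim_{t\to\infty}\sigma(t)X$ (flat limit) is the closed subscheme of $P(V)$ defined by the ideal generated by all $Lt(f)$, $f\in I$. A $\mathbf G_0$-equivariant $\mathbb C^*$-degeneration of $(X,L)$ in $P(V)\times\mathbb C$ is a closed subvariety $\mathcal X\subset P(V)\times\mathbb C$, with $\mathcal L=\mathcal O(1)|_{\mathcal X}$, that is flat over $\mathbb C$, invariant under the $\mathbb C^*$-action on $P(V)\times\mathbb C$ given by a linear algebraic $\mathbb C^*$-action on $V$ and the standard action on $\mathbb C$, has fiber $\mathcal X_1=X$ over $1$ and all fibers $\mathcal X_c$, $c\neq0$, projectively isomorphic to $X$ (so $(\mathcal X_c,\mathcal L|_{\mathcal X_c})\cong(X,L^r)$), and is preserved by $\mathbf G_0$ (acting trivially on $\mathbb C$), where the $\mathbf G_0$-action commutes with the $\mathbb C^*$-action. Its central fiber is $\mathcal X_0$, the fiber over $0$. Proposition. Let $\sigma$ be a $\mathbf G_0$-equivariant real 1-PS in $GL(V)$. Then there is a sequence of $\mathbf G_0$-equivariant real 1-PS $\tau_i$ $(i\in\mathbb N)$, diagonal in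 the same basis as $\sigma$, with rational eigenvalues that converge to the corresponding eigenvalues of $\sigma$ as $i\to\infty$, such that $\mathcal X_0^{\tau_i}=\mathcal X_0^\sigma$ for all $i$. Moreover, for every $i$ there are an integer $N>0$ and a $\mathbf G_0$-equivariant $\mathbb C^*$-degeneration $\mathcal X\subset P(V)\times\mathbb C$ of $(X,L)$ whose $\mathbb C^*$-action is generated by $\tau_i(Nt)$ (that is, $e^{-t}\in\mathbb C^*$ acts on $V$ as $\tau_i(Nt)$ for $t\in\mathbb R$), and whose central fiber is $\mathcal X_0^\sigma$; if $\mathcal X_0^\sigma$ is reduced, then $\mathcal X$ is normal. -/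

import Mathlib

open Polynomial Filter Topology

noncomputable section

/-! Conventions.  `V` is a finite-dimensional complex vector space, thought of as a space of sections
`H⁰(X, L^r)`, so that the elements of `V` are the homogeneous coordinates (linear forms) on the
projective space `P(V)`, whose homogeneous coordinate ring is `Sym V`.  A closed subscheme of
`P(V)` is given by a homogeneous ideal of `Sym V`, a closed subscheme of `P(V) × ℂ` by an ideal of
`(Sym V)[s]`, homogeneous in the `Sym V`-direction; the variable `s` of the polynomial ring is the
coordinate of `ℂ`.  A linear automorphism of `V` acts on ideals of `Sym V` by functoriality of
`Sym`. -/

section Sym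

variable {V : Type*} [AddCommGroup V] [Module ℂ V]

/-- The degree `d` part `Sym^d V` of the symmetric algebra. -/
def symPower (V : Type*) [AddCommGroup V] [Module ℂ V] (d : ℕ) :
    Submodule ℂ (SymmetricAlgebra ℂ V) :=
  (LinearMap.range (SymmetricAlgebra.ι ℂ V)) ^ d

/-- The algebra endomorphism `Sym φ` of `Sym V` induced by a linear endomorphism `φ` of `V`. -/
def symMap (φ : V →ₗ[ℂ] V) : SymmetricAlgebra ℂ V →ₐ[ℂ] SymmetricAlgebra ℂ V :=
  SymmetricAlgebra.lift (SymmetricAlgebra.ι ℂ V ∘ₗ φ)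

/-- A homogeneous ideal of `Sym V`: one generated by homogeneous elements. -/
def IsHomogeneousIdeal (I : Ideal (SymmetricAlgebra ℂ V)) : Prop :=
  I = Ideal.span {f | f ∈ I ∧ ∃ d, f ∈ symPower V d}

/-- The coordinate ring of the affine chart `{v = 1}` of the closed subscheme of `P(V)` (or of
`P(V) × ℂ`) with ideal `J`, for a linear form `v`. -/
abbrev AffineChart {R : Type*} [CommRing R] (J : Ideal R) (v : R) : Type _ :=
  R ⧸ (J ⊔ Ideal.span {v - 1})

/-- `I` is the homogeneous ideal of a (nonempty, irreducible, reduced) normal closed subvariety `X`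
of `P(V)`.  Such an `X` is polarized by `O(1)|_X`. -/
structure IsNormalProjectiveVariety (I : Ideal (SymmetricAlgebra ℂ V)) : Prop where
  homogeneous : IsHomogeneousIdeal I
  isPrime : I.IsPrime
  nonempty : ∃ v : V, SymmetricAlgebra.ι ℂ V v ∉ I
  normal : ∀ v : V, SymmetricAlgebra.ι ℂ V v ∉ I →
    IsIntegrallyClosed (AffineChart I (SymmetricAlgebra.ι ℂ V v))

/-- The closed subscheme of `P(V)` with homogeneous ideal `I` is reduced. -/
def IsReducedSubscheme (I : Ideal (SymmetricAlgebra ℂ V)) : Prop :=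
  ∀ v : V, IsReduced (AffineChart I (SymmetricAlgebra.ι ℂ V v))

/-- The linear action `ρ` of `G` on `V` preserves the closed subscheme of `P(V)` with ideal `I`;
that is, `ρ` comes from an action of `G` on `X` together with its line bundle `O(1)|_X`. -/
def PreservesSubscheme {G : Type*} [Group G] (ρ : Representation ℂ G V)
    (I : Ideal (SymmetricAlgebra ℂ V)) : Prop :=
  ∀ g : G, ∀ f ∈ I, symMap (ρ g) f ∈ I

end Sym

/-- The sum `Lt(f)` of the terms `c_α x^α` of `f` whose `lam`-weight `⟨α, lam⟩ = ∑ α_i lam_i` is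
minimal among the terms occurring in `f`. -/
def initialForm {n : ℕ} (lam : Fin n → ℝ) (f : MvPolynomial (Fin n) ℂ) :
    MvPolynomial (Fin n) ℂ :=
  open Classical in
  ∑ α ∈ f.support with ∀ β ∈ f.support, ∑ i, (α i : ℝ) * lam i ≤ ∑ i, (β i : ℝ) * lam i,
    MvPolynomial.monomial α (f.coeff α)

/-- A real one-parameter subgroup `σ(t) = diag(e^{-λ₁ t}, …, e^{-λₙ t})` of `GL(V)` with respect to
some basis of `V`; the `λᵢ` are called its eigenvalues. -/
structure RealOnePS (n : ℕ) (V : Type*) [AddCommGroup V] [Module ℂ V] where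
  basis : Module.Basis (Fin n) ℂ V
  eigenvalue : Fin n → ℝ

namespace RealOnePS

variable {n : ℕ} {V : Type*} [AddCommGroup V] [Module ℂ V]

/-- The linear map `σ(t)`. -/
def toLinearMap (σ : RealOnePS n V) (t : ℝ) : V →ₗ[ℂ] V :=
  σ.basis.constr ℂ fun i => (Real.exp (-(σ.eigenvalue i) * t) : ℂ) • σ.basis i

/-- `σ` is `G`-equivariant: `σ(t)` commutes with the action of `G` on `V`. -/
def IsEquivariant (σ : RealOnePS n V) {G : Type*} [Group G] (ρ : Representation ℂ G V) : Prop :=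
  ∀ (t : ℝ) (g : G), Commute (σ.toLinearMap t) (ρ g)

/-- All eigenvalues are rational. -/
def HasRationalEigenvalues (σ : RealOnePS n V) : Prop :=
  ∀ i, ∃ q : ℚ, σ.eigenvalue i = q

/-- The homogeneous ideal of the central fiber `X₀^σ = lim_{t → ∞} σ(t) X` (flat limit) of the
degeneration `(X, σ)`, where `X ⊆ P(V)` has ideal `I`: it is generated by the `Lt(f)`, `f ∈ I`,
where `Sym V` is identified with the polynomial ring through the basis that diagonalizes `σ`. -/
def centralFiber (σ : RealOnePS n V) (I : Ideal (SymmetricAlgebra ℂ V)) :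
    Ideal (SymmetricAlgebra ℂ V) :=
  Ideal.span {h | ∃ f ∈ I, h = (SymmetricAlgebra.equivMvPolynomial σ.basis).symm
    (initialForm σ.eigenvalue (SymmetricAlgebra.equivMvPolynomial σ.basis f))}

end RealOnePS

section Degeneration

variable {V : Type*} [AddCommGroup V] [Module ℂ V]

/-- The ideal in `Sym V` of the fiber over `s = c` of the closed subscheme of `P(V) × ℂ` with
ideal `J`. -/
def fiberIdeal (J : Ideal (SymmetricAlgebra ℂ V)[X]) (c : ℂ) : Ideal (SymmetricAlgebra ℂ V) :=
  J.map (evalRingHom (algebraMap ℂ (SymmetricAlgebra ℂ V) c))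

/-- The transform `(Sym φ)(F(c⁻¹ s))` of `F(s)` under the automorphism `(φ, s ↦ c s)` of
`P(V) × ℂ`. -/
def transformPoly (φ : V ≃ₗ[ℂ] V) (c : ℂˣ) (F : (SymmetricAlgebra ℂ V)[X]) :
    (SymmetricAlgebra ℂ V)[X] :=
  (F.map (symMap φ.toLinearMap : SymmetricAlgebra ℂ V →+* SymmetricAlgebra ℂ V)).comp
    (C (algebraMap ℂ (SymmetricAlgebra ℂ V) ((c⁻¹ : ℂˣ) : ℂ)) * Polynomial.X)

/-- A `ℂ*`-degeneration of the polarized variety `(X, O(1)|_X)`, where `X ⊆ P(V)` has homogeneous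
ideal `I`, realized inside `P(V) × ℂ`: a closed subvariety `𝒳` of `P(V) × ℂ`, flat over `ℂ`, with
a `ℂ*`-action that covers the standard action on `ℂ`, whose fiber over `1` is `X`, and whose fibers
over all `c ≠ 0` are projectively isomorphic to `X`.  The line bundle is `𝒪(1)|_𝒳`; the
`ℂ*`-action on `(𝒳, 𝒪(1)|_𝒳)` is the restriction of an algebraic linear one on `P(V) × ℂ`. -/
structure CStarDegeneration (I : Ideal (SymmetricAlgebra ℂ V)) where
  /-- the ideal of `𝒳` -/
  ideal : Ideal (SymmetricAlgebra ℂ V)[X]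
  homogeneous : ideal = Ideal.span {F | F ∈ ideal ∧ ∃ d, ∀ k, F.coeff k ∈ symPower V d}
  isPrime : ideal.IsPrime
  /-- the map `𝒳 → ℂ` is flat -/
  flat : RingHom.Flat (R := ℂ[X]) (S := (SymmetricAlgebra ℂ V)[X] ⧸ ideal)
    ((Ideal.Quotient.mk ideal).comp (mapRingHom (algebraMap ℂ (SymmetricAlgebra ℂ V))))
  /-- the `ℂ*`-action -/
  action : ℂˣ →* (V ≃ₗ[ℂ] V)
  /-- the `ℂ*`-action is algebraic, that is, diagonalizable with integral weights -/
  algebraic : ∃ (n : ℕ) (b : Module.Basis (Fin n) ℂ V) (k : Fin n → ℤ),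
    ∀ (c : ℂˣ) (i : Fin n), action c (b i) = ((c ^ k i : ℂˣ) : ℂ) • b i
  equivariant : ∀ (c : ℂˣ), ∀ F ∈ ideal, transformPoly (action c) c F ∈ ideal
  fiber_one : fiberIdeal ideal 1 = I
  fiber_iso : ∀ c : ℂ, c ≠ 0 → ∃ φ : V ≃ₗ[ℂ] V,
    fiberIdeal ideal c =
      I.map (symMap φ.toLinearMap : SymmetricAlgebra ℂ V →+* SymmetricAlgebra ℂ V)

namespace CStarDegeneration

variable {I : Ideal (SymmetricAlgebra ℂ V)}

/-- The ideal of the central fiber `𝒳₀`. -/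
def centralFiber (D : CStarDegeneration I) : Ideal (SymmetricAlgebra ℂ V) :=
  fiberIdeal D.ideal 0

/-- The degeneration is `G`-equivariant: the action of `G` on `P(V) × ℂ`, through `ρ` on `P(V)` and
trivial on `ℂ`, preserves `𝒳` and commutes with the `ℂ*`-action.  (As `𝒳₁ = X` in `P(V)`, the
identification of `X` with the fiber over `1` is then `G`-equivariant.) -/
def IsEquivariant (D : CStarDegeneration I) {G : Type*} [Group G]
    (ρ : Representation ℂ G V) : Prop :=
  (∀ g : G, ∀ F ∈ D.ideal,
    F.map (symMap (ρ g) : SymmetricAlgebra ℂ V →+* SymmetricAlgebra ℂ V) ∈ D.ideal) ∧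
  ∀ (c : ℂˣ) (g : G), Commute (D.action c).toLinearMap (ρ g)

/-- The total space `𝒳` is normal. -/
def IsNormal (D : CStarDegeneration I) : Prop :=
  ∀ v : V, C (SymmetricAlgebra.ι ℂ V v) ∉ D.ideal →
    IsIntegrallyClosed (AffineChart D.ideal (C (SymmetricAlgebra.ι ℂ V v)))

/-- The `ℂ*`-action of the degeneration is generated by `t ↦ τ(N t)`, under `c = e^{-t}`. -/
def IsGeneratedBy (D : CStarDegeneration I) {n : ℕ} (τ : RealOnePS n V) (N : ℕ) : Prop :=
  ∀ (t : ℝ) (c : ℂˣ), (c : ℂ) = (Real.exp (-t) : ℂ) →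
    (D.action c).toLinearMap = τ.toLinearMap (N * t)

end CStarDegeneration

end Degeneration

end

/-! The proof works in coordinates that diagonalize `σ`, where `Sym V` becomes a polynomial ring
and the central fiber is the scheme defined by an initial ideal.

*Rational weights.* Take `ℚ`-linear forms on the rational span of the eigenvalues `λᵢ` that
converge pointwise to the inclusion into `ℝ` (`exists_linearMap_rat_tendsto`), and let `τ` be the
image of `λ` under such a form. Then `τ` satisfies every rational linear relation of `λ`: it is
constant on the eigenspaces of `σ`, hence equivariant, and ties between monomials persist. Strict
inequalities between finitely many monomials persist as soon as `τ` is close to `λ`, so the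
finitely many generators `Lt(f)` of the initial ideal for `λ` are also initial forms for `τ`. This
gives one inclusion of initial ideals; as both have the Hilbert function of `I`
(`finrank_initialSpan_le`, `finrank_le_initialSpan`), they are equal (`initialIdeal_eq_of_le`).

*The degeneration.* Let `kᵢ = N τᵢ` be integers. The total space is defined by the kernel
`degenerationIdeal` of `(Sym V)[X] → (Sym V ⧸ I)[T;T⁻¹]`, `xᵢ ↦ xᵢ T ^ (-kᵢ)`, `X ↦ T`. It is
prime, and flat because the quotient is torsion-free over `ℂ[X]`. Its elements of given weight
are, up to a power of `X`, the homogenizations of the elements of `I` with respect to `k`, whence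
the fiber over `0` is defined by the initial forms (`fiberIdeal_zero_degenerationIdeal`).

*Normality.* The chart `{v = 1}` is realized as the subring `R` of a field generated by `T` and
the `T ^ (-kᵢ) xᵢ / v`. Away from `T = 0` it is covered by open sets that it shares with the
charts `{xᵢ = 1}` of the product of `X` with the affine line; these are polynomial rings over
normal rings, hence normal. Therefore `y` in the fraction field and integral over `R` satisfies
`T ^ M y ∈ R` for some `M` (`exists_pow_mul_mem_chart`). If the central fiber is reduced then `T R`
is a radical ideal, and an integral equation for `y` allows one to cancel the powers of `T`
(`mem_of_mul_mem_of_isIntegral`). -/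

/-! ### Initial forms and Hilbert functions -/

section InitialForm

variable {n : ℕ}

theorem weight_eq_sum (lam : Fin n → ℝ) (α : Fin n →₀ ℕ) :
    Finsupp.weight lam α = ∑ i, (α i : ℝ) * lam i := by
  simp [Finsupp.weight_apply, Finsupp.sum_fintype]

theorem initialForm_zero (lam : Fin n → ℝ) : initialForm lam 0 = 0 := by
  simp [initialForm]

theorem initialForm_eq_component (lam : Fin n → ℝ) (f : MvPolynomial (Fin n) ℂ) (m : ℝ)
    (hm : ∀ β ∈ f.support, m ≤ Finsupp.weight lam β)
    (hm' : ∃ α ∈ f.support, Finsupp.weight lam α = m) :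
    initialForm lam f = MvPolynomial.weightedHomogeneousComponent lam m f := by
  classical
  obtain ⟨α₀, hα₀, hw₀⟩ := hm'
  rw [initialForm, MvPolynomial.weightedHomogeneousComponent_apply]
  refine Finset.sum_congr ?_ fun _ _ => rfl
  ext α
  simp only [Finset.mem_filter, ← weight_eq_sum]
  constructor
  · rintro ⟨h1, h2⟩
    exact ⟨h1, le_antisymm (hw₀ ▸ h2 α₀ hα₀) (hm α h1)⟩
  · rintro ⟨h1, h2⟩
    exact ⟨h1, fun β hβ => h2 ▸ hm β hβ⟩

/-- The weight component at a lower bound `m` for the weights of `f` vanishes unless `m` is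
attained, in which case it is the initial form. -/
theorem component_eq_zero_or_initialForm (lam : Fin n → ℝ) (f : MvPolynomial (Fin n) ℂ) (m : ℝ)
    (hm : ∀ β ∈ f.support, m ≤ Finsupp.weight lam β) :
    MvPolynomial.weightedHomogeneousComponent lam m f = 0 ∨
      initialForm lam f = MvPolynomial.weightedHomogeneousComponent lam m f := by
  by_cases h : ∃ α ∈ f.support, Finsupp.weight lam α = m
  · exact Or.inr (initialForm_eq_component lam f m hm h)
  · push Not at h
    exact Or.inl (MvPolynomial.weightedHomogeneousComponent_eq_zero' m f h)

theorem exists_initialForm_eq (lam : Fin n → ℝ) {f : MvPolynomial (Fin n) ℂ} (hf : f ≠ 0) :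
    ∃ m, (∀ β ∈ f.support, m ≤ Finsupp.weight lam β) ∧
      (∃ α ∈ f.support, Finsupp.weight lam α = m) ∧
      initialForm lam f = MvPolynomial.weightedHomogeneousComponent lam m f ∧
      initialForm lam f ≠ 0 := by
  classical
  obtain ⟨α, hα, hmin⟩ := f.support.exists_min_image (fun β => Finsupp.weight lam β)
    (MvPolynomial.support_nonempty.2 hf)
  have h := initialForm_eq_component lam f _ hmin ⟨α, hα, rfl⟩
  refine ⟨_, hmin, ⟨α, hα, rfl⟩, h, fun h0 => ?_⟩
  have := congrArg (MvPolynomial.coeff α) (h ▸ h0)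
  rw [MvPolynomial.coeff_weightedHomogeneousComponent] at this
  simp at this
  exact (MvPolynomial.mem_support_iff.1 hα) this

theorem initialForm_support_subset (lam : Fin n → ℝ) (f : MvPolynomial (Fin n) ℂ) :
    (initialForm lam f).support ⊆ f.support := by
  classical
  rcases eq_or_ne f 0 with rfl | hf
  · simp [initialForm_zero]
  obtain ⟨m, -, -, h, -⟩ := exists_initialForm_eq lam hf
  rw [h, MvPolynomial.support_weightedHomogeneousComponent]
  exact Finset.filter_subset _ _

theorem initialForm_monomial_mul (lam : Fin n → ℝ) (β : Fin n →₀ ℕ)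
    (f : MvPolynomial (Fin n) ℂ) :
    initialForm lam (MvPolynomial.monomial β 1 * f) =
      MvPolynomial.monomial β 1 * initialForm lam f := by
  classical
  rcases eq_or_ne f 0 with rfl | hf
  · simp [initialForm_zero]
  obtain ⟨m, h1, ⟨α, hα, hαm⟩, h, -⟩ := exists_initialForm_eq lam hf
  rw [h, initialForm_eq_component lam _ (Finsupp.weight lam β + m)]
  · ext γ
    simp only [MvPolynomial.coeff_weightedHomogeneousComponent, MvPolynomial.coeff_monomial_mul']
    by_cases hγ : β ≤ γ
    · have : Finsupp.weight lam γ = Finsupp.weight lam β + Finsupp.weight lam (γ - β) := by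
        rw [← map_add, add_tsub_cancel_of_le hγ]
      simp [hγ, this]
    · simp [hγ]
  · intro γ hγ
    rw [MvPolynomial.mem_support_iff, MvPolynomial.coeff_monomial_mul'] at hγ
    by_cases hle : β ≤ γ
    · have : Finsupp.weight lam γ = Finsupp.weight lam β + Finsupp.weight lam (γ - β) := by
        rw [← map_add, add_tsub_cancel_of_le hle]
      simp only [hle, if_true, one_mul] at hγ
      have := h1 (γ - β) (MvPolynomial.mem_support_iff.2 hγ)
      linarith
    · simp [hle] at hγ
  · refine ⟨β + α, ?_, by rw [map_add, hαm]⟩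
    rw [MvPolynomial.mem_support_iff, MvPolynomial.coeff_monomial_mul]
    simpa using hα

theorem homogeneousComponent_initialForm (lam : Fin n → ℝ) (f : MvPolynomial (Fin n) ℂ) (d : ℕ) :
    MvPolynomial.homogeneousComponent d (initialForm lam f) = 0 ∨
      MvPolynomial.homogeneousComponent d (initialForm lam f) =
        initialForm lam (MvPolynomial.homogeneousComponent d f) := by
  classical
  rcases eq_or_ne f 0 with rfl | hf
  · simp [initialForm_zero]
  obtain ⟨m, h1, -, h, -⟩ := exists_initialForm_eq lam hf
  have key : MvPolynomial.homogeneousComponent d (initialForm lam f) =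
      MvPolynomial.weightedHomogeneousComponent lam m
        (MvPolynomial.homogeneousComponent d f) := by
    rw [h]
    ext γ
    simp only [MvPolynomial.coeff_weightedHomogeneousComponent,
      MvPolynomial.coeff_homogeneousComponent]
    split_ifs <;> rfl
  rw [key]
  refine (component_eq_zero_or_initialForm lam _ m fun β hβ => h1 β ?_).imp_right Eq.symm
  rw [MvPolynomial.mem_support_iff, MvPolynomial.coeff_homogeneousComponent] at hβ
  rw [MvPolynomial.mem_support_iff]
  split_ifs at hβ with hd
  · exact hβ
  · exact absurd rfl hβ

/-- The linear span of the initial forms of the elements of `U`. -/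
noncomputable def initialSpan (lam : Fin n → ℝ) (U : Submodule ℂ (MvPolynomial (Fin n) ℂ)) :
    Submodule ℂ (MvPolynomial (Fin n) ℂ) :=
  Submodule.span ℂ (initialForm lam '' U)

theorem linearIndependent_of_initialForm (lam : Fin n → ℝ) {ι : Type*}
    (g : ι → MvPolynomial (Fin n) ℂ)
    (h : LinearIndependent ℂ fun i => initialForm lam (g i)) : LinearIndependent ℂ g := by
  classical
  have hg : ∀ i, g i ≠ 0 := fun i h0 => h.ne_zero i (by simp [h0, initialForm_zero])
  choose m h1 h2 h3 h4 using fun i => exists_initialForm_eq lam (hg i)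
  rw [linearIndependent_iff']
  intro s a hsum
  by_contra! hne
  obtain ⟨i, his, hi⟩ := hne
  obtain ⟨i₀, hi₀, hmin⟩ := (s.filter fun i => a i ≠ 0).exists_min_image m
    ⟨i, by simp [his, hi]⟩
  rw [Finset.mem_filter] at hi₀
  -- the component of the relation in the least weight `m i₀` is a relation of initial forms
  have := congrArg (MvPolynomial.weightedHomogeneousComponent lam (m i₀)) hsum
  rw [map_sum, map_zero] at this
  have key : ∑ j ∈ s, (if m j = m i₀ then a j else 0) • initialForm lam (g j) = 0 := by
    rw [← this]
    refine Finset.sum_congr rfl fun j hj => ?_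
    rw [map_smul]
    by_cases haj : a j = 0
    · simp [haj]
    split_ifs with hjm
    · rw [h3 j, hjm]
    · rw [zero_smul, MvPolynomial.weightedHomogeneousComponent_eq_zero', smul_zero]
      intro β hβ hβm
      have l1 := h1 j β hβ
      have l2 := hmin j (by simp [hj, haj])
      exact hjm (le_antisymm (hβm ▸ l1) l2)
  have := (linearIndependent_iff'.1 h) s _ key i₀ hi₀.1
  simp at this
  exact hi₀.2 this

theorem finrank_initialSpan_le (lam : Fin n → ℝ) (U : Submodule ℂ (MvPolynomial (Fin n) ℂ))
    [FiniteDimensional ℂ U] :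
    Module.finrank ℂ (initialSpan lam U) ≤ Module.finrank ℂ U := by
  obtain ⟨b, hb, hspan, hli⟩ := exists_linearIndependent ℂ (initialForm lam '' U)
  choose g hgU hg using fun e : b => hb e.2
  have hli' : LinearIndependent ℂ g := by
    apply linearIndependent_of_initialForm lam
    simpa only [hg] using hli
  have hli'' : LinearIndependent ℂ (fun e => (⟨g e, hgU e⟩ : U)) :=
    LinearIndependent.of_comp U.subtype hli'
  have := hli''.finite
  have := Fintype.ofFinite b
  rw [initialSpan, ← hspan, finrank_span_set_eq_card hli, Set.toFinset_card]
  exact hli''.fintype_card_le_finrank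

/-- A maximal set of degree `d` monomials that is independent modulo the initial forms of `U`
spans a complement of the initial forms, and this complement does not meet `U`. -/
theorem finrank_le_initialSpan (lam : Fin n → ℝ) (d : ℕ)
    (U : Submodule ℂ (MvPolynomial (Fin n) ℂ))
    (hU : U ≤ MvPolynomial.homogeneousSubmodule (Fin n) ℂ d) :
    Module.finrank ℂ U ≤ Module.finrank ℂ (initialSpan lam U) := by
  classical
  set W := MvPolynomial.homogeneousSubmodule (Fin n) ℂ d with hW
  set L := initialSpan lam U with hL
  have hWfin : FiniteDimensional ℂ W :=
    Module.Finite.iff_fg.2 (MvPolynomial.homogeneousSubmodule_fg _ _ d)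
  have hWsupp : W = MvPolynomial.restrictSupport ℂ {α : Fin n →₀ ℕ | α.degree = d} := by
    rw [hW, MvPolynomial.homogeneousSubmodule_eq_finsupp_supported]
    rfl
  have hfin : {α : Fin n →₀ ℕ | α.degree = d}.Finite := by
    have hfd : FiniteDimensional ℂ
        (MvPolynomial.restrictSupport ℂ {α : Fin n →₀ ℕ | α.degree = d}) := hWsupp ▸ hWfin
    have := (MvPolynomial.basisRestrictSupport ℂ {α : Fin n →₀ ℕ | α.degree = d})
    exact Module.Finite.finite_basis this
  have hLW : L ≤ W := by
    refine Submodule.span_le.2 ?_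
    rintro _ ⟨f, hf, rfl⟩
    have h1 := hU hf
    rw [hWsupp] at h1 ⊢
    exact fun α hα => h1 (initialForm_support_subset lam f hα)
  obtain ⟨A, ⟨hAd, hAdisj⟩, hAmax⟩ := Set.Finite.exists_maximal
    (s := {A : Set (Fin n →₀ ℕ) | A ⊆ {α | α.degree = d} ∧
      Disjoint (MvPolynomial.restrictSupport ℂ A) L})
    (hfin.finite_subsets.subset fun A hA => hA.1)
    ⟨∅, Set.empty_subset _, by
      rw [MvPolynomial.restrictSupport_eq_span]; simp⟩
  set B := MvPolynomial.restrictSupport ℂ A with hB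
  have hBW : B ≤ W := hWsupp ▸ MvPolynomial.restrictSupport_mono _ hAd
  have hBfin : FiniteDimensional ℂ B := Submodule.finiteDimensional_of_le hBW
  have hLfin : FiniteDimensional ℂ L := Submodule.finiteDimensional_of_le hLW
  have hUfin : FiniteDimensional ℂ U := Submodule.finiteDimensional_of_le hU
  have hWBL : W ≤ B ⊔ L := by
    rw [hWsupp, MvPolynomial.restrictSupport_eq_span, Submodule.span_le]
    rintro _ ⟨α, hα, rfl⟩
    by_contra hnot
    have hins : insert α A ∈ {A : Set (Fin n →₀ ℕ) | A ⊆ {α | α.degree = d} ∧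
      Disjoint (MvPolynomial.restrictSupport ℂ A) L} := by
      refine ⟨Set.insert_subset hα hAd, ?_⟩
      rw [Submodule.disjoint_def]
      intro x hx hxL
      rw [MvPolynomial.restrictSupport_eq_span, Set.image_insert_eq,
        Submodule.mem_span_insert] at hx
      obtain ⟨c, z, hz, rfl⟩ := hx
      rw [← MvPolynomial.restrictSupport_eq_span] at hz
      have hc : c = 0 := by
        by_contra hc
        refine hnot ?_
        have : (MvPolynomial.monomial α (1 : ℂ)) =
            c⁻¹ • ((-z) + (c • MvPolynomial.monomial α 1 + z)) := by
          rw [neg_add_cancel_comm_assoc, smul_smul, inv_mul_cancel₀ hc, one_smul]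
        simp only [SetLike.mem_coe]
        rw [this]
        exact Submodule.smul_mem _ _ (Submodule.add_mem_sup (Submodule.neg_mem _ hz) hxL)
      subst hc
      rw [zero_smul, zero_add] at hxL ⊢
      exact Submodule.disjoint_def.1 hAdisj z hz hxL
    have hαA : α ∈ A := hAmax hins (Set.subset_insert _ _) (Set.mem_insert _ _)
    exact hnot (Submodule.mem_sup_left (by
      rw [hB, MvPolynomial.monomial_mem_restrictSupport]; exact Or.inl hαA))
  have hUB : U ⊓ B = ⊥ := by
    rw [eq_bot_iff]
    rintro f ⟨hfU, hfB⟩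
    by_contra hf0
    obtain ⟨m, -, -, -, hne⟩ := exists_initialForm_eq lam hf0
    refine hne (Submodule.disjoint_def.1 hAdisj _ ?_ ?_)
    · exact fun α hα => hfB (initialForm_support_subset lam f hα)
    · exact Submodule.subset_span ⟨f, hfU, rfl⟩
  have e1 := Submodule.finrank_sup_add_finrank_inf_eq U B
  have e2 := Submodule.finrank_mono (sup_le hU hBW)
  have e3 := Submodule.finrank_mono hWBL
  have e4 := Submodule.finrank_add_le_finrank_add_finrank B L
  rw [hUB, finrank_bot] at e1
  omega

/-- The ideal generated by the initial forms of the elements of `I`. -/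
noncomputable def initialIdeal (lam : Fin n → ℝ) (I : Ideal (MvPolynomial (Fin n) ℂ)) :
    Ideal (MvPolynomial (Fin n) ℂ) :=
  Ideal.span (initialForm lam '' I)

theorem homogeneousComponent_mem_initialSpan (lam : Fin n → ℝ)
    (I : Ideal (MvPolynomial (Fin n) ℂ))
    (hI : ∀ f ∈ I, ∀ d, MvPolynomial.homogeneousComponent d f ∈ I) (d : ℕ)
    {h : MvPolynomial (Fin n) ℂ} (hh : h ∈ initialIdeal lam I) :
    MvPolynomial.homogeneousComponent d h ∈ initialSpan lam
      (I.restrictScalars ℂ ⊓ MvPolynomial.homogeneousSubmodule (Fin n) ℂ d) := by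
  refine Submodule.span_induction (p := fun h _ => ∀ g : MvPolynomial (Fin n) ℂ,
    MvPolynomial.homogeneousComponent d (g * h) ∈ initialSpan lam
      (I.restrictScalars ℂ ⊓ MvPolynomial.homogeneousSubmodule (Fin n) ℂ d))
    ?_ ?_ ?_ ?_ hh 1 |> fun H => by simpa using H
  · rintro _ ⟨f, hf, rfl⟩ g
    induction g using MvPolynomial.induction_on' with
    | monomial β c =>
      have : MvPolynomial.monomial β c * initialForm lam f =
          c • initialForm lam (MvPolynomial.monomial β 1 * f) := by
        rw [initialForm_monomial_mul, ← smul_mul_assoc, MvPolynomial.smul_monomial,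
          smul_eq_mul, mul_one]
      rw [this, map_smul]
      refine Submodule.smul_mem _ _ ?_
      rcases homogeneousComponent_initialForm lam (MvPolynomial.monomial β 1 * f) d with h0 | h0
      · rw [h0]; exact Submodule.zero_mem _
      · rw [h0]
        exact Submodule.subset_span ⟨_, ⟨hI _ (I.mul_mem_left _ hf) d,
          MvPolynomial.homogeneousComponent_mem _ _⟩, rfl⟩
    | add p q hp hq =>
      rw [add_mul, map_add]
      exact Submodule.add_mem _ hp hq
  · intro g; simp
  · intro x y _ _ hx hy g
    rw [mul_add, map_add]
    exact Submodule.add_mem _ (hx g) (hy g)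
  · intro a x _ hx g
    rw [smul_eq_mul, ← mul_assoc]
    exact hx _

/-- Two initial ideals of the same homogeneous ideal have the same Hilbert function; hence they
agree as soon as one contains the other. -/
theorem initialIdeal_eq_of_le (lam mu : Fin n → ℝ) (I : Ideal (MvPolynomial (Fin n) ℂ))
    (hI : ∀ f ∈ I, ∀ d, MvPolynomial.homogeneousComponent d f ∈ I)
    (hle : initialIdeal lam I ≤ initialIdeal mu I) : initialIdeal lam I = initialIdeal mu I := by
  classical
  refine le_antisymm hle (Ideal.span_le.2 ?_)
  rintro _ ⟨f, hf, rfl⟩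
  rw [← MvPolynomial.sum_homogeneousComponent (initialForm mu f)]
  refine Ideal.sum_mem _ fun d _ => ?_
  set U := I.restrictScalars ℂ ⊓ MvPolynomial.homogeneousSubmodule (Fin n) ℂ d with hU
  have hWfin : FiniteDimensional ℂ (MvPolynomial.homogeneousSubmodule (Fin n) ℂ d) :=
    Module.Finite.iff_fg.2 (MvPolynomial.homogeneousSubmodule_fg _ _ d)
  have hUfin : FiniteDimensional ℂ U := Submodule.finiteDimensional_of_le inf_le_right
  have hsub : initialSpan lam U ≤ initialSpan mu U := by
    refine Submodule.span_le.2 ?_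
    rintro _ ⟨g, hg, rfl⟩
    have h1 := homogeneousComponent_mem_initialSpan mu I hI d
      (hle (Ideal.subset_span ⟨g, hg.1, rfl⟩))
    rwa [MvPolynomial.homogeneousComponent_of_mem (n := d), if_pos rfl] at h1
    rw [MvPolynomial.homogeneousSubmodule_eq_finsupp_supported]
    have h2 := hg.2
    rw [MvPolynomial.homogeneousSubmodule_eq_finsupp_supported] at h2
    exact fun α hα => h2 (initialForm_support_subset lam g hα)
  have hfin : FiniteDimensional ℂ (initialSpan mu U) := by
    refine Submodule.finiteDimensional_of_le
      (S₂ := MvPolynomial.homogeneousSubmodule (Fin n) ℂ d) (Submodule.span_le.2 ?_)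
    rintro _ ⟨g, hg, rfl⟩
    have h2 := hg.2
    rw [MvPolynomial.homogeneousSubmodule_eq_finsupp_supported] at h2 ⊢
    exact fun α hα => h2 (initialForm_support_subset mu g hα)
  have heq : initialSpan lam U = initialSpan mu U :=
    Submodule.eq_of_le_of_finrank_le hsub
      ((finrank_initialSpan_le mu U).trans (finrank_le_initialSpan lam d U inf_le_right))
  have hmem := homogeneousComponent_mem_initialSpan mu I hI d
    (Ideal.subset_span ⟨f, hf, rfl⟩ : initialForm mu f ∈ initialIdeal mu I)
  rw [← hU, ← heq] at hmem
  have : initialSpan lam U ≤ (initialIdeal lam I).restrictScalars ℂ := by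
    refine Submodule.span_le.2 ?_
    rintro _ ⟨g, hg, rfl⟩
    exact Ideal.subset_span ⟨g, hg.1, rfl⟩
  exact this hmem

end InitialForm

/-! ### Rational approximation of weights -/

section Approximation

variable {n : ℕ}

theorem initialForm_congr (lam mu : Fin n → ℝ) (f : MvPolynomial (Fin n) ℂ)
    (h : ∀ α ∈ f.support, ∀ β ∈ f.support,
      Finsupp.weight lam α ≤ Finsupp.weight lam β ↔ Finsupp.weight mu α ≤ Finsupp.weight mu β) :
    initialForm lam f = initialForm mu f := by
  classical
  simp only [initialForm, ← weight_eq_sum]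
  refine Finset.sum_congr (Finset.filter_congr fun α hα => ?_) fun _ _ => rfl
  exact forall₂_congr fun β hβ => h α hα β hβ

/-- The inclusion of a finite-dimensional rational subspace of `ℝ` is a pointwise limit of
`ℚ`-linear forms: perturb the images of a basis to rational numbers. -/
theorem exists_linearMap_rat_tendsto (W : Submodule ℚ ℝ) [FiniteDimensional ℚ W] :
    ∃ T : ℕ → W →ₗ[ℚ] ℚ, ∀ w : W, Tendsto (fun l => ((T l w : ℚ) : ℝ)) atTop (𝓝 (w : ℝ)) := by
  let b := Module.finBasis ℚ W
  have hseq : ∀ j, ∃ q : ℕ → ℚ, Tendsto (fun l => (q l : ℝ)) atTop (𝓝 (b j : ℝ)) := fun j => by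
    obtain ⟨u, hu, hlim⟩ := mem_closure_iff_seq_limit.1
      (Rat.isDenseEmbedding_coe_real.dense ((b j : W) : ℝ))
    choose q hq using hu
    exact ⟨q, by simpa only [hq] using hlim⟩
  choose q hq using hseq
  refine ⟨fun l => b.constr ℚ fun j => q j l, fun w => ?_⟩
  have h1 : ∀ l, (((b.constr ℚ fun j => q j l) w : ℚ) : ℝ) =
      ∑ j, ((b.repr w j : ℚ) : ℝ) * (q j l : ℝ) := fun l => by
    simp [Module.Basis.constr_apply_fintype, Module.Basis.equivFun_apply]
  have h2 : (w : ℝ) = ∑ j, ((b.repr w j : ℚ) : ℝ) * ((b j : W) : ℝ) := by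
    have := congrArg W.subtype (b.sum_repr w)
    rw [map_sum] at this
    simpa [Rat.smul_def] using this.symm
  simp only [h1]
  rw [h2]
  exact tendsto_finsetSum _ fun j _ => (hq j).const_mul _

/-- Rational weights that satisfy the rational linear relations of `lam` and are close to `lam`
have the same initial ideal: the finitely many generators of the initial ideal keep their initial
forms, and equality follows by comparing Hilbert functions. -/
theorem exists_rational_weights (lam : Fin n → ℝ) (I : Ideal (MvPolynomial (Fin n) ℂ))
    (hI : ∀ f ∈ I, ∀ d, MvPolynomial.homogeneousComponent d f ∈ I) :
    ∃ tau : ℕ → Fin n → ℝ, (∀ l i, ∃ q : ℚ, tau l i = q) ∧ Tendsto tau atTop (𝓝 lam) ∧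
      (∀ l i j, lam i = lam j → tau l i = tau l j) ∧
      ∀ l, initialIdeal (tau l) I = initialIdeal lam I := by
  classical
  set W : Submodule ℚ ℝ := Submodule.span ℚ (Set.range lam) with hW
  have hfd : FiniteDimensional ℚ W := FiniteDimensional.span_of_finite ℚ (Set.finite_range lam)
  obtain ⟨T, hT⟩ := exists_linearMap_rat_tendsto W
  let x : Fin n → W := fun i => ⟨lam i, Submodule.subset_span ⟨i, rfl⟩⟩
  let tau : ℕ → Fin n → ℝ := fun l i => (T l (x i) : ℚ)
  have htau : Tendsto tau atTop (𝓝 lam) := tendsto_pi_nhds.2 fun i => hT (x i)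
  let y : (Fin n →₀ ℕ) → W := fun α => Finsupp.weight x α
  have hy : ∀ α, ((y α : W) : ℝ) = Finsupp.weight lam α := fun α => by
    simp [y, x, Finsupp.weight_apply, Finsupp.sum_fintype]
  have hTy : ∀ l α, ((T l (y α) : ℚ) : ℝ) = Finsupp.weight (tau l) α := fun l α => by
    simp [y, tau, Finsupp.weight_apply, Finsupp.sum_fintype]
  have hcmp : ∀ α β : Fin n →₀ ℕ, ∀ᶠ l in atTop, Finsupp.weight lam α ≤ Finsupp.weight lam β ↔
      Finsupp.weight (tau l) α ≤ Finsupp.weight (tau l) β := by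
    intro α β
    rcases lt_trichotomy (Finsupp.weight lam α) (Finsupp.weight lam β) with h | h | h
    · have := (hT (y α)).eventually_lt (hT (y β)) (by rwa [hy, hy])
      filter_upwards [this] with l hl
      rw [hTy, hTy] at hl
      exact iff_of_true h.le hl.le
    · have hαβ : y α = y β := Subtype.ext (by rw [hy, hy, h])
      refine Eventually.of_forall fun l => iff_of_true h.le ?_
      rw [← hTy, ← hTy, hαβ]
    · have := (hT (y β)).eventually_lt (hT (y α)) (by rwa [hy, hy])
      filter_upwards [this] with l hl
      rw [hTy, hTy] at hl
      exact iff_of_false h.not_ge hl.not_ge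
  have hform : ∀ f : MvPolynomial (Fin n) ℂ, ∀ᶠ l in atTop,
      initialForm lam f = initialForm (tau l) f := by
    intro f
    have : ∀ᶠ l in atTop, ∀ α ∈ f.support, ∀ β ∈ f.support,
        Finsupp.weight lam α ≤ Finsupp.weight lam β ↔
          Finsupp.weight (tau l) α ≤ Finsupp.weight (tau l) β :=
      (Finset.eventually_all _).2 fun α _ => (Finset.eventually_all _).2 fun β _ => hcmp α β
    filter_upwards [this] with l hl
    exact initialForm_congr _ _ _ hl
  obtain ⟨t, hts, htspan⟩ := (Submodule.fg_span_iff_fg_span_finset_subset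
    (initialForm lam '' (I : Set (MvPolynomial (Fin n) ℂ)))).1
      (IsNoetherian.noetherian (initialIdeal lam I))
  have hev : ∀ᶠ l in atTop, initialIdeal lam I ≤ initialIdeal (tau l) I := by
    have : ∀ᶠ l in atTop, ∀ h ∈ t, h ∈ initialIdeal (tau l) I := by
      refine (Finset.eventually_all _).2 fun h hh => ?_
      obtain ⟨f, hf, rfl⟩ := hts hh
      filter_upwards [hform f] with l hl
      rw [hl]
      exact Ideal.subset_span ⟨f, hf, rfl⟩
    filter_upwards [this] with l hl
    rw [initialIdeal, Ideal.span, htspan]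
    exact Submodule.span_le.2 hl
  obtain ⟨l₀, hl₀⟩ := eventually_atTop.1 hev
  refine ⟨fun l => tau (l + l₀), fun l i => ⟨_, rfl⟩, htau.comp (tendsto_add_atTop_nat l₀), ?_, ?_⟩
  · intro l i j hij
    have : x i = x j := Subtype.ext hij
    simp only [tau, this]
  · intro l
    exact (initialIdeal_eq_of_le lam _ I hI (hl₀ _ (Nat.le_add_left _ _))).symm

end Approximation

noncomputable section

/-! ### Coordinates on the symmetric algebra -/

section Coordinates

variable {V : Type*} [AddCommGroup V] [Module ℂ V] {n : ℕ} (b : Module.Basis (Fin n) ℂ V)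

/-- The isomorphism of `Sym V` with a polynomial ring given by a basis of `V`. -/
abbrev coordEquiv : SymmetricAlgebra ℂ V ≃ₐ[ℂ] MvPolynomial (Fin n) ℂ :=
  SymmetricAlgebra.equivMvPolynomial b

/-- The element of `Sym V` corresponding to the monomial with exponent `α`. -/
def symMonomial (α : Fin n →₀ ℕ) : SymmetricAlgebra ℂ V :=
  (coordEquiv b).symm (MvPolynomial.monomial α 1)

theorem symMonomial_zero : symMonomial b 0 = 1 := by
  simp [symMonomial]

theorem symMonomial_add (α β : Fin n →₀ ℕ) :
    symMonomial b (α + β) = symMonomial b α * symMonomial b β := by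
  rw [symMonomial, symMonomial, symMonomial, ← map_mul, MvPolynomial.monomial_mul, one_mul]

theorem symMonomial_single (i : Fin n) (j : ℕ) :
    symMonomial b (Finsupp.single i j) = SymmetricAlgebra.ι ℂ V (b i) ^ j := by
  rw [symMonomial, ← MvPolynomial.X_pow_eq_monomial, map_pow,
    SymmetricAlgebra.equivMvPolynomial_symm_X]

theorem coordEquiv_symMonomial (α : Fin n →₀ ℕ) :
    coordEquiv b (symMonomial b α) = MvPolynomial.monomial α 1 := by
  simp [symMonomial]

theorem sym_induction {p : SymmetricAlgebra ℂ V → Prop}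
    (monomial : ∀ α (c : ℂ), p (c • symMonomial b α)) (add : ∀ f g, p f → p g → p (f + g))
    (f : SymmetricAlgebra ℂ V) : p f := by
  suffices ∀ g, p ((coordEquiv b).symm g) by simpa using this (coordEquiv b f)
  intro g
  induction g using MvPolynomial.induction_on' with
  | monomial α c =>
    have := monomial α c
    rwa [symMonomial, ← map_smul, MvPolynomial.smul_monomial, smul_eq_mul, mul_one] at this
  | add p q hp hq => rw [map_add]; exact add _ _ hp hq

theorem symMonomial_mem_symPower (α : Fin n →₀ ℕ) : symMonomial b α ∈ symPower V α.degree := by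
  induction α using Finsupp.induction_linear with
  | zero =>
    rw [symMonomial_zero, map_zero, symPower, pow_zero]
    exact Submodule.one_le.1 le_rfl
  | add α β hα hβ =>
    rw [symMonomial_add, map_add, symPower, pow_add]
    exact Submodule.mul_mem_mul hα hβ
  | single i j =>
    rw [symMonomial_single, Finsupp.degree_single]
    exact Submodule.pow_mem_pow _ (LinearMap.mem_range_self _ (b i)) j

theorem mem_symPower_iff (d : ℕ) (f : SymmetricAlgebra ℂ V) :
    f ∈ symPower V d ↔ (coordEquiv b f).IsHomogeneous d := by
  constructor
  · intro hf
    refine Submodule.pow_induction_on_left' (LinearMap.range (SymmetricAlgebra.ι ℂ V))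
      (C := fun d f _ => (coordEquiv b f).IsHomogeneous d) ?_ ?_ ?_ hf
    · intro r
      rw [AlgEquiv.commutes]
      exact MvPolynomial.isHomogeneous_C _ _
    · intro x y i _ _ hx hy
      rw [map_add]
      exact hx.add hy
    · rintro _ ⟨v, rfl⟩ i x _ hx
      rw [map_mul, Nat.succ_eq_add_one, add_comm]
      refine MvPolynomial.IsHomogeneous.mul ?_ hx
      rw [← b.sum_repr v]
      simp only [map_sum, map_smul, SymmetricAlgebra.equivMvPolynomial_ι_apply]
      refine MvPolynomial.IsHomogeneous.sum _ _ _ fun i _ => ?_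
      rw [MvPolynomial.smul_eq_C_mul]
      exact (MvPolynomial.isHomogeneous_X _ i).C_mul _
  · intro hf
    have : f = ∑ α ∈ (coordEquiv b f).support, (coordEquiv b f).coeff α • symMonomial b α := by
      apply (coordEquiv b).injective
      conv_lhs => rw [(coordEquiv b f).as_sum]
      simp only [map_sum, map_smul, coordEquiv_symMonomial]
      refine Finset.sum_congr rfl fun α _ => ?_
      rw [MvPolynomial.smul_monomial, smul_eq_mul, mul_one]
    rw [this]
    refine Submodule.sum_mem _ fun α hα => Submodule.smul_mem _ _ ?_
    have hd := hf (MvPolynomial.mem_support_iff.1 hα)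
    have : α.degree = d := by
      rw [← hd, Finsupp.degree_eq_weight_one]; rfl
    exact this ▸ symMonomial_mem_symPower b α

/-- The projection of `Sym V` onto its degree `d` part. -/
def symComponent (d : ℕ) : SymmetricAlgebra ℂ V →ₗ[ℂ] SymmetricAlgebra ℂ V :=
  (coordEquiv b).symm.toLinearMap ∘ₗ MvPolynomial.homogeneousComponent d ∘ₗ
    (coordEquiv b).toLinearMap

theorem coordEquiv_symComponent (d : ℕ) (f : SymmetricAlgebra ℂ V) :
    coordEquiv b (symComponent b d f) = MvPolynomial.homogeneousComponent d (coordEquiv b f) := by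
  simp [symComponent]

theorem symComponent_mem (d : ℕ) (f : SymmetricAlgebra ℂ V) :
    symComponent b d f ∈ symPower V d := by
  rw [mem_symPower_iff b, coordEquiv_symComponent]
  exact MvPolynomial.homogeneousComponent_isHomogeneous d _

theorem sum_symComponent (f : SymmetricAlgebra ℂ V) {D : ℕ}
    (hD : (coordEquiv b f).totalDegree < D) :
    ∑ d ∈ Finset.range D, symComponent b d f = f := by
  apply (coordEquiv b).injective
  simp only [map_sum, coordEquiv_symComponent]
  rw [← Finset.sum_subset (Finset.range_mono (Nat.succ_le_of_lt hD))]
  · exact MvPolynomial.sum_homogeneousComponent _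
  · intro d _ hd
    refine MvPolynomial.homogeneousComponent_eq_zero _ _ ?_
    simpa using hd

variable {I : Ideal (SymmetricAlgebra ℂ V)}

theorem homogeneousComponent_mem_map (hI : IsHomogeneousIdeal I) :
    ∀ f ∈ I.map (coordEquiv b), ∀ d, MvPolynomial.homogeneousComponent d f ∈
      I.map (coordEquiv b) := by
  let : GradedAlgebra (MvPolynomial.homogeneousSubmodule (Fin n) ℂ) :=
    MvPolynomial.gradedAlgebra
  have h : (I.map (coordEquiv b)).IsHomogeneous
      (MvPolynomial.homogeneousSubmodule (Fin n) ℂ) := by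
    rw [hI, Ideal.map_span]
    refine Ideal.homogeneous_span _ _ ?_
    rintro _ ⟨f, ⟨-, d, hd⟩, rfl⟩
    exact ⟨d, (mem_symPower_iff b d f).1 hd⟩
  exact fun f hf d => MvPolynomial.homogeneousComponent_mem_of_mem h hf d

theorem mem_map_coordEquiv {f : SymmetricAlgebra ℂ V} :
    coordEquiv b f ∈ I.map (coordEquiv b) ↔ f ∈ I := by
  constructor
  · intro h
    obtain ⟨g, hg, hgf⟩ := (Ideal.mem_map_iff_of_surjective _ (coordEquiv b).surjective).1 h
    rwa [← (coordEquiv b).injective hgf]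
  · exact fun h => Ideal.mem_map_of_mem _ h

theorem symComponent_mem_of_mem (hI : IsHomogeneousIdeal I) {f : SymmetricAlgebra ℂ V}
    (hf : f ∈ I) (d : ℕ) : symComponent b d f ∈ I := by
  rw [← mem_map_coordEquiv b, coordEquiv_symComponent]
  exact homogeneousComponent_mem_map b hI _ (Ideal.mem_map_of_mem _ hf) d

/-- Ring homomorphisms out of `(Sym V)[X]` are determined by the images of the constants, of a
basis of `V` and of `X`. -/
theorem polynomial_sym_hom_ext {A : Type*} [CommRing A]
    {f g : (SymmetricAlgebra ℂ V)[X] →+* A}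
    (h1 : ∀ c : ℂ, f (C (algebraMap ℂ _ c)) = g (C (algebraMap ℂ _ c)))
    (h2 : ∀ i, f (C (SymmetricAlgebra.ι ℂ V (b i))) = g (C (SymmetricAlgebra.ι ℂ V (b i))))
    (h3 : f X = g X) : f = g := by
  refine Polynomial.ringHom_ext' (RingHom.ext fun s => ?_) h3
  simp only [RingHom.comp_apply]
  induction s using SymmetricAlgebra.induction with
  | algebraMap r => exact h1 r
  | ι x =>
    rw [← b.sum_repr x]
    simp only [map_sum, map_smul, Algebra.smul_def, map_mul, h1, h2]
  | mul a b ha hb => simp only [map_mul, ha, hb]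
  | add a b ha hb => simp only [map_add, ha, hb]

end Coordinates

/-! ### The total space of the degeneration -/

section TotalSpace

variable {V : Type*} [AddCommGroup V] [Module ℂ V] {n : ℕ} (b : Module.Basis (Fin n) ℂ V)
  (k : Fin n → ℤ)

/-- The homomorphism `Sym V → (Sym V)[T;T⁻¹]` given by `xᵢ ↦ xᵢ T ^ (-kᵢ)`. -/
def twist : SymmetricAlgebra ℂ V →ₐ[ℂ] LaurentPolynomial (SymmetricAlgebra ℂ V) :=
  SymmetricAlgebra.lift (b.constr ℂ fun i =>
    LaurentPolynomial.C (SymmetricAlgebra.ι ℂ V (b i)) * LaurentPolynomial.T (-k i))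

/-- The homomorphism `(Sym V)[X] → (Sym V)[T;T⁻¹]` given by `xᵢ ↦ xᵢ T ^ (-kᵢ)`, `X ↦ T`. -/
def laurentHom : (SymmetricAlgebra ℂ V)[X] →+* LaurentPolynomial (SymmetricAlgebra ℂ V) :=
  eval₂RingHom (twist b k : SymmetricAlgebra ℂ V →+* LaurentPolynomial (SymmetricAlgebra ℂ V))
    (LaurentPolynomial.T 1)

/-- The homomorphism `(Sym V)[X] → (Sym V ⧸ I)[T;T⁻¹]` given by `xᵢ ↦ xᵢ T ^ (-kᵢ)`, `X ↦ T`. -/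
def degenerationHom (I : Ideal (SymmetricAlgebra ℂ V)) :
    (SymmetricAlgebra ℂ V)[X] →+* LaurentPolynomial (SymmetricAlgebra ℂ V ⧸ I) :=
  (AddMonoidAlgebra.mapRingHom ℤ (Ideal.Quotient.mk I)).comp (laurentHom b k)

/-- The ideal of the closure in `P(V) × ℂ` of the family over `ℂ*` whose fiber over `c` is the
transform of `X` under the diagonal matrix with entries `c ^ kᵢ`, where `X` has ideal `I`. -/
def degenerationIdeal (I : Ideal (SymmetricAlgebra ℂ V)) : Ideal (SymmetricAlgebra ℂ V)[X] :=
  RingHom.ker (degenerationHom b k I)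

variable {I : Ideal (SymmetricAlgebra ℂ V)}

theorem mem_degenerationIdeal {F : (SymmetricAlgebra ℂ V)[X]} :
    F ∈ degenerationIdeal b k I ↔ ∀ m, (laurentHom b k F).coeff m ∈ I := by
  rw [degenerationIdeal, RingHom.mem_ker, degenerationHom, RingHom.comp_apply]
  constructor
  · intro h m
    have := congrArg (fun p : LaurentPolynomial (SymmetricAlgebra ℂ V ⧸ I) => p.coeff m) h
    simpa [Ideal.Quotient.eq_zero_iff_mem] using this
  · intro h
    refine LaurentPolynomial.ext fun m => ?_
    simpa [Ideal.Quotient.eq_zero_iff_mem] using h m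

theorem twist_ι (i : Fin n) : twist b k (SymmetricAlgebra.ι ℂ V (b i)) =
    LaurentPolynomial.C (SymmetricAlgebra.ι ℂ V (b i)) * LaurentPolynomial.T (-k i) := by
  simp [twist]

theorem twist_symMonomial (α : Fin n →₀ ℕ) : twist b k (symMonomial b α) =
    LaurentPolynomial.C (symMonomial b α) * LaurentPolynomial.T (-Finsupp.weight k α) := by
  induction α using Finsupp.induction_linear with
  | zero => simp [symMonomial_zero]
  | add α β hα hβ =>
    rw [symMonomial_add, map_mul, hα, hβ, map_add, map_mul, neg_add, LaurentPolynomial.T_add]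
    ring
  | single i j =>
    rw [symMonomial_single, map_pow, twist_ι, mul_pow, ← map_pow, LaurentPolynomial.T_pow]
    simp [Finsupp.weight_single]

theorem laurentHom_C (f : SymmetricAlgebra ℂ V) : laurentHom b k (C f) = twist b k f := by
  simp [laurentHom]

theorem laurentHom_X : laurentHom b k X = LaurentPolynomial.T 1 := by
  simp [laurentHom]

theorem laurentHom_monomial (j : ℕ) (c : ℂ) (α : Fin n →₀ ℕ) :
    laurentHom b k (monomial j (c • symMonomial b α)) =
      LaurentPolynomial.C (c • symMonomial b α) *
        LaurentPolynomial.T (j - Finsupp.weight k α) := by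
  rw [← C_mul_X_pow_eq_monomial, map_mul, map_pow, laurentHom_C, laurentHom_X, map_smul,
    twist_symMonomial, LaurentPolynomial.T_pow, sub_eq_neg_add, LaurentPolynomial.T_add,
    Algebra.smul_def, Algebra.smul_def, map_mul, LaurentPolynomial.algebraMap_apply, mul_one]
  ring

theorem mapRingHom_laurent_C {A B : Type*} [CommRing A] [CommRing B] (f : A →+* B) (a : A) :
    AddMonoidAlgebra.mapRingHom ℤ f (LaurentPolynomial.C a) = LaurentPolynomial.C (f a) := by
  rw [← LaurentPolynomial.single_eq_C, ← LaurentPolynomial.single_eq_C]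
  simp [-LaurentPolynomial.single_eq_C_mul_T]

theorem mapRingHom_laurent_T {A B : Type*} [CommRing A] [CommRing B] (f : A →+* B) (m : ℤ) :
    AddMonoidAlgebra.mapRingHom ℤ f (LaurentPolynomial.T m) = LaurentPolynomial.T m := by
  simp [LaurentPolynomial.T, -LaurentPolynomial.single_eq_C_mul_T]

theorem degenerationHom_algebraMap (c : ℂ) :
    degenerationHom b k I (C (algebraMap ℂ _ c)) = LaurentPolynomial.C (algebraMap ℂ _ c) := by
  rw [degenerationHom, RingHom.comp_apply, laurentHom_C, AlgHom.commutes,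
    LaurentPolynomial.algebraMap_apply, mapRingHom_laurent_C]
  rfl

theorem degenerationHom_ι (i : Fin n) :
    degenerationHom b k I (C (SymmetricAlgebra.ι ℂ V (b i))) =
      LaurentPolynomial.C (Ideal.Quotient.mk I (SymmetricAlgebra.ι ℂ V (b i))) *
        LaurentPolynomial.T (-k i) := by
  rw [degenerationHom, RingHom.comp_apply, laurentHom_C, twist_ι, map_mul, mapRingHom_laurent_C,
    mapRingHom_laurent_T]

theorem degenerationHom_X : degenerationHom b k I X = LaurentPolynomial.T 1 := by
  rw [degenerationHom, RingHom.comp_apply, laurentHom_X, mapRingHom_laurent_T]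

theorem polynomial_sym_induction {p : (SymmetricAlgebra ℂ V)[X] → Prop}
    (mono : ∀ j α (c : ℂ), p (monomial j (c • symMonomial b α)))
    (add : ∀ F G, p F → p G → p (F + G)) (F : (SymmetricAlgebra ℂ V)[X]) : p F := by
  induction F using Polynomial.induction_on' with
  | add F G hF hG => exact add F G hF hG
  | monomial j f =>
    induction f using sym_induction b with
    | monomial α c => exact mono j α c
    | add f g hf hg => rw [map_add]; exact add _ _ hf hg

/-- The coefficient of `x^α T^m` in the image of `F` is that of `x^α X^(m + ⟨α, k⟩)` in `F`. -/
theorem coeff_laurentHom (F : (SymmetricAlgebra ℂ V)[X]) (m : ℤ) (α : Fin n →₀ ℕ) :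
    (coordEquiv b ((laurentHom b k F).coeff m)).coeff α =
      if 0 ≤ m + Finsupp.weight k α then
        (coordEquiv b (F.coeff (m + Finsupp.weight k α).toNat)).coeff α else 0 := by
  classical
  induction F using polynomial_sym_induction b with
  | add F G hF hG =>
    simp only [map_add, AddMonoidAlgebra.coeff_add, Finsupp.add_apply, MvPolynomial.coeff_add,
      hF, hG, Polynomial.coeff_add]
    split_ifs <;> simp
  | mono j β c =>
    rw [laurentHom_monomial, ← LaurentPolynomial.single_eq_C_mul_T, AddMonoidAlgebra.coeff_single,
      Finsupp.single_apply, coeff_monomial]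
    by_cases hβ : β = α
    · subst hβ
      by_cases hj : (j : ℤ) - Finsupp.weight k β = m
      · have h1 : m + Finsupp.weight k β = j := by omega
        simp [hj, h1]
      · rw [if_neg hj]
        split_ifs with h0 h1
        · omega
        · simp
        · simp
    · have : (coordEquiv b (c • symMonomial b β)).coeff α = 0 := by
        rw [map_smul, coordEquiv_symMonomial, MvPolynomial.coeff_smul, MvPolynomial.coeff_monomial,
          if_neg hβ, smul_zero]
      split_ifs <;> simp only [this, map_zero, MvPolynomial.coeff_zero]

theorem degenerationIdeal_isPrime (hI : I.IsPrime) : (degenerationIdeal b k I).IsPrime :=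
  have : NoZeroDivisors (LaurentPolynomial (SymmetricAlgebra ℂ V ⧸ I)) := inferInstance
  have : IsDomain (LaurentPolynomial (SymmetricAlgebra ℂ V ⧸ I)) := NoZeroDivisors.to_isDomain _
  RingHom.ker_isPrime _

/-- Evaluation of Laurent polynomials at `T = 1` recovers the fiber over `1`. -/
theorem eval_one_mem {F : (SymmetricAlgebra ℂ V)[X]} (hF : F ∈ degenerationIdeal b k I) :
    F.eval 1 ∈ I := by
  have h : (LaurentPolynomial.eval₂ (RingHom.id (SymmetricAlgebra ℂ V ⧸ I)) 1).comp
      (degenerationHom b k I) = (Ideal.Quotient.mk I).comp (evalRingHom 1) := by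
    refine polynomial_sym_hom_ext b (fun c => ?_) (fun i => ?_) ?_
    · simp [degenerationHom_algebraMap]
    · simp [degenerationHom_ι]
    · simp [degenerationHom_X]
  rw [← Ideal.Quotient.eq_zero_iff_mem]
  have := congrArg (fun g => g F) h
  simp only [RingHom.comp_apply, coe_evalRingHom] at this
  rw [← this, (RingHom.mem_ker.1 hF), map_zero]

/-- The homogenization of `f` with respect to the weights `k`; here `m` is a lower bound for the
weights of the terms of `f`, and the term `c x^α` becomes `c x^α X^(⟨α, k⟩ - m)`. -/
def weightHomogenization (f : SymmetricAlgebra ℂ V) (m : ℤ) : (SymmetricAlgebra ℂ V)[X] :=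
  ∑ α ∈ (coordEquiv b f).support,
    monomial (Finsupp.weight k α - m).toNat ((coordEquiv b f).coeff α • symMonomial b α)

theorem sum_coeff_smul_symMonomial (f : SymmetricAlgebra ℂ V) :
    ∑ α ∈ (coordEquiv b f).support, (coordEquiv b f).coeff α • symMonomial b α = f := by
  apply (coordEquiv b).injective
  conv_rhs => rw [(coordEquiv b f).as_sum]
  simp only [map_sum, map_smul, coordEquiv_symMonomial]
  refine Finset.sum_congr rfl fun α _ => ?_
  rw [MvPolynomial.smul_monomial, smul_eq_mul, mul_one]

theorem laurentHom_weightHomogenization (f : SymmetricAlgebra ℂ V) (m : ℤ)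
    (hm : ∀ α ∈ (coordEquiv b f).support, m ≤ Finsupp.weight k α) :
    laurentHom b k (weightHomogenization b k f m) =
      LaurentPolynomial.C f * LaurentPolynomial.T (-m) := by
  rw [weightHomogenization, map_sum]
  conv_rhs => rw [← sum_coeff_smul_symMonomial b f, map_sum, Finset.sum_mul]
  refine Finset.sum_congr rfl fun α hα => ?_
  rw [laurentHom_monomial]
  congr 2
  have := hm α hα
  omega

theorem weightHomogenization_mem {f : SymmetricAlgebra ℂ V} (hf : f ∈ I) (m : ℤ)
    (hm : ∀ α ∈ (coordEquiv b f).support, m ≤ Finsupp.weight k α) :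
    weightHomogenization b k f m ∈ degenerationIdeal b k I := by
  rw [mem_degenerationIdeal]
  intro j
  rw [laurentHom_weightHomogenization b k f m hm, ← LaurentPolynomial.single_eq_C_mul_T,
    AddMonoidAlgebra.coeff_single, Finsupp.single_apply]
  split_ifs
  · exact hf
  · exact I.zero_mem

theorem eval_one_weightHomogenization (f : SymmetricAlgebra ℂ V) (m : ℤ) :
    (weightHomogenization b k f m).eval 1 = f := by
  rw [weightHomogenization, eval_finsetSum]
  simp only [eval_monomial, one_pow, mul_one]
  exact sum_coeff_smul_symMonomial b f

theorem weight_intCast (α : Fin n →₀ ℕ) :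
    Finsupp.weight (fun i => (k i : ℝ)) α = ((Finsupp.weight k α : ℤ) : ℝ) := by
  simp [Finsupp.weight_apply, Finsupp.sum_fintype]

theorem coeff_zero_weightHomogenization (f : SymmetricAlgebra ℂ V) (m : ℤ)
    (hm : ∀ α ∈ (coordEquiv b f).support, m ≤ Finsupp.weight k α) :
    (coordEquiv b ((weightHomogenization b k f m).coeff 0)) =
      MvPolynomial.weightedHomogeneousComponent (fun i => (k i : ℝ)) m (coordEquiv b f) := by
  classical
  rw [MvPolynomial.weightedHomogeneousComponent_apply, weightHomogenization, finsetSum_coeff,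
    map_sum, Finset.sum_filter]
  refine Finset.sum_congr rfl fun α hα => ?_
  have h1 := hm α hα
  rw [coeff_monomial, weight_intCast]
  by_cases h : Finsupp.weight k α = m
  · simp only [h, sub_self, Int.toNat_zero, if_true]
    rw [map_smul, coordEquiv_symMonomial, MvPolynomial.smul_monomial, smul_eq_mul, mul_one]
  · rw [if_neg (by omega), if_neg (by exact_mod_cast h), map_zero]

theorem exists_weight_le (f : SymmetricAlgebra ℂ V) :
    ∃ m : ℤ, ∀ α ∈ (coordEquiv b f).support, m ≤ Finsupp.weight k α := by
  obtain ⟨m, hm⟩ := ((coordEquiv b f).support.image (Finsupp.weight k)).bddBelow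
  exact ⟨m, fun α hα => hm (Finset.mem_image_of_mem _ hα)⟩

theorem mem_fiberIdeal_iff {J : Ideal (SymmetricAlgebra ℂ V)[X]} {c : ℂ}
    {f : SymmetricAlgebra ℂ V} :
    f ∈ fiberIdeal J c ↔ ∃ F ∈ J, F.eval (algebraMap ℂ _ c) = f := by
  rw [fiberIdeal, Ideal.mem_map_iff_of_surjective _ fun f => ⟨C f, by simp⟩]
  rfl

theorem fiberIdeal_one_degenerationIdeal : fiberIdeal (degenerationIdeal b k I) 1 = I := by
  ext f
  rw [mem_fiberIdeal_iff, map_one]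
  constructor
  · rintro ⟨F, hF, rfl⟩
    exact eval_one_mem b k hF
  · intro hf
    obtain ⟨m, hm⟩ := exists_weight_le b k f
    exact ⟨_, weightHomogenization_mem b k hf m hm, eval_one_weightHomogenization b k f m⟩

/-- The fiber over `0` is defined by the initial forms: the constant term in `X` of an element `F`
of the ideal is a sum of weight components of least weight of elements of `I`. -/
theorem fiberIdeal_zero_degenerationIdeal :
    fiberIdeal (degenerationIdeal b k I) 0 =
      Ideal.span {h | ∃ f ∈ I, h = (coordEquiv b).symm
        (initialForm (fun i => (k i : ℝ)) (coordEquiv b f))} := by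
  classical
  refine le_antisymm ?_ (Ideal.span_le.2 ?_)
  · intro f hf
    obtain ⟨F, hF, rfl⟩ := mem_fiberIdeal_iff.1 hf
    rw [map_zero, ← coeff_zero_eq_eval_zero]
    set P := laurentHom b k F with hP
    have hsum : F.coeff 0 = ∑ m ∈ P.coeff.support, (coordEquiv b).symm
        (MvPolynomial.weightedHomogeneousComponent (fun i => (k i : ℝ)) ((-m : ℤ) : ℝ)
          (coordEquiv b (P.coeff m))) := by
      apply (coordEquiv b).injective
      rw [map_sum]
      ext α
      simp only [AlgEquiv.apply_symm_apply, MvPolynomial.coeff_sum,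
        MvPolynomial.coeff_weightedHomogeneousComponent, weight_intCast, Int.cast_inj]
      have h0 := coeff_laurentHom b k F (-Finsupp.weight k α) α
      rw [if_pos (by omega), neg_add_cancel, Int.toNat_zero, ← hP] at h0
      rw [Finset.sum_eq_single (-Finsupp.weight k α)]
      · rw [neg_neg, if_pos rfl, h0]
      · intro m _ hm
        rw [if_neg (by omega)]
      · intro hm
        rw [Finsupp.notMem_support_iff.1 hm]
        simp
    rw [hsum]
    refine Ideal.sum_mem _ fun m _ => ?_
    have hbound : ∀ α ∈ (coordEquiv b (P.coeff m)).support,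
        ((-m : ℤ) : ℝ) ≤ Finsupp.weight (fun i => (k i : ℝ)) α := by
      intro α hα
      rw [MvPolynomial.mem_support_iff, hP, coeff_laurentHom] at hα
      rw [weight_intCast, Int.cast_le]
      by_contra hlt
      exact hα (if_neg (by omega))
    rcases component_eq_zero_or_initialForm _ _ _ hbound with h | h
    · rw [h, map_zero]; exact Ideal.zero_mem _
    · exact Ideal.subset_span ⟨P.coeff m, (mem_degenerationIdeal b k).1 hF m, by rw [h]⟩
  · rintro _ ⟨f, hf, rfl⟩
    rw [SetLike.mem_coe, mem_fiberIdeal_iff]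
    rcases eq_or_ne (coordEquiv b f) 0 with h0 | h0
    · exact ⟨0, Ideal.zero_mem _, by simp [h0, initialForm_zero]⟩
    obtain ⟨m, h1, ⟨α, hα, hαm⟩, h2, -⟩ := exists_initialForm_eq (fun i => (k i : ℝ)) h0
    have hm : ∀ β ∈ (coordEquiv b f).support, Finsupp.weight k α ≤ Finsupp.weight k β := by
      intro β hβ
      have := h1 β hβ
      rw [← hαm, weight_intCast, weight_intCast] at this
      exact_mod_cast this
    refine ⟨_, weightHomogenization_mem b k hf _ hm, ?_⟩
    apply (coordEquiv b).injective
    rw [map_zero, ← coeff_zero_eq_eval_zero, coeff_zero_weightHomogenization b k f _ hm,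
      AlgEquiv.apply_symm_apply, h2, ← hαm, weight_intCast]

/-- The part of `F` of degree `d` in the `Sym V`-direction. -/
def polyComponent (d : ℕ) (F : (SymmetricAlgebra ℂ V)[X]) : (SymmetricAlgebra ℂ V)[X] :=
  ∑ j ∈ F.support, monomial j (symComponent b d (F.coeff j))

theorem coeff_polyComponent (d : ℕ) (F : (SymmetricAlgebra ℂ V)[X]) (j : ℕ) :
    (polyComponent b d F).coeff j = symComponent b d (F.coeff j) := by
  classical
  simp only [polyComponent, finsetSum_coeff, coeff_monomial]
  rw [Finset.sum_ite_eq' F.support j]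
  split_ifs with h
  · rfl
  · rw [notMem_support_iff.1 h, map_zero]

theorem exists_sum_polyComponent (F : (SymmetricAlgebra ℂ V)[X]) :
    ∃ D, F = ∑ d ∈ Finset.range D, polyComponent b d F := by
  classical
  obtain ⟨D, hD⟩ := (F.support.image fun j =>
    (coordEquiv b (F.coeff j)).totalDegree).bddAbove
  refine ⟨D + 1, ?_⟩
  ext j : 1
  rw [finsetSum_coeff]
  simp only [coeff_polyComponent]
  by_cases hj : j ∈ F.support
  · exact (sum_symComponent b _ (Nat.lt_succ_of_le (hD (Finset.mem_image_of_mem _ hj)))).symm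
  · simp [notMem_support_iff.1 hj]

theorem degenerationIdeal_homogeneous (hI : IsHomogeneousIdeal I) :
    degenerationIdeal b k I = Ideal.span {F | F ∈ degenerationIdeal b k I ∧
      ∃ d, ∀ j, F.coeff j ∈ symPower V d} := by
  refine le_antisymm (fun F hF => ?_) (Ideal.span_le.2 fun F hF => hF.1)
  have hmem : ∀ d, polyComponent b d F ∈ degenerationIdeal b k I := by
    intro d
    rw [mem_degenerationIdeal]
    intro m
    have : (laurentHom b k (polyComponent b d F)).coeff m =
        symComponent b d ((laurentHom b k F).coeff m) := by
      apply (coordEquiv b).injective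
      ext α
      rw [coeff_laurentHom, coeff_polyComponent, coordEquiv_symComponent,
        coordEquiv_symComponent, MvPolynomial.coeff_homogeneousComponent,
        MvPolynomial.coeff_homogeneousComponent, coeff_laurentHom]
      split_ifs <;> rfl
    rw [this]
    exact symComponent_mem_of_mem b hI ((mem_degenerationIdeal b k).1 hF m) d
  obtain ⟨D, hD⟩ := exists_sum_polyComponent b F
  rw [hD]
  exact Ideal.sum_mem _ fun d _ => Ideal.subset_span
    ⟨hmem d, d, fun j => by rw [coeff_polyComponent]; exact symComponent_mem b d _⟩

theorem degenerationHom_mapRingHom_injective (hI : I ≠ ⊤) :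
    Function.Injective ((degenerationHom b k I).comp
      (mapRingHom (algebraMap ℂ (SymmetricAlgebra ℂ V)))) := by
  have : Nontrivial (SymmetricAlgebra ℂ V ⧸ I) := Ideal.Quotient.nontrivial_iff.2 hI
  have h : (degenerationHom b k I).comp (mapRingHom (algebraMap ℂ (SymmetricAlgebra ℂ V))) =
      (toLaurent).comp (mapRingHom (algebraMap ℂ (SymmetricAlgebra ℂ V ⧸ I))) := by
    refine Polynomial.ringHom_ext' (RingHom.ext fun c => ?_) ?_
    · simp [degenerationHom_algebraMap]
    · simp [degenerationHom_X]
  rw [h]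
  exact toLaurent_injective.comp
    (Polynomial.map_injective _ (FaithfulSMul.algebraMap_injective ℂ _))

theorem flat_of_injective {A B : Type*} [CommRing A] [IsDedekindDomain A] [CommRing B] [IsDomain B]
    (φ : A →+* B) (hφ : Function.Injective φ) : φ.Flat := by
  let := φ.toAlgebra
  have : FaithfulSMul A B := (faithfulSMul_iff_algebraMap_injective _ _).2 hφ
  change Module.Flat A B
  infer_instance

theorem degenerationIdeal_flat (hI : I.IsPrime) :
    RingHom.Flat (R := ℂ[X]) (S := (SymmetricAlgebra ℂ V)[X] ⧸ degenerationIdeal b k I)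
      ((Ideal.Quotient.mk (degenerationIdeal b k I)).comp
        (mapRingHom (algebraMap ℂ (SymmetricAlgebra ℂ V)))) := by
  have := degenerationIdeal_isPrime b k hI
  refine flat_of_injective _ ((injective_iff_map_eq_zero _).2 fun p hp => ?_)
  rw [RingHom.comp_apply, Ideal.Quotient.eq_zero_iff_mem, degenerationIdeal,
    RingHom.mem_ker] at hp
  exact (injective_iff_map_eq_zero _).1 (degenerationHom_mapRingHom_injective b k hI.ne_top) p hp

end TotalSpace

/-! ### The `ℂ*`-action and the action of the group -/

section Action

variable {V : Type*} [AddCommGroup V] [Module ℂ V] {n : ℕ} (b : Module.Basis (Fin n) ℂ V)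
  (k : Fin n → ℤ)

/-- The linear map that is diagonal in the basis `b`, with diagonal entries `a`. -/
def diagMap (a : Fin n → ℂ) : V →ₗ[ℂ] V :=
  b.constr ℂ fun i => a i • b i

@[simp]
theorem diagMap_basis (a : Fin n → ℂ) (i : Fin n) : diagMap b a (b i) = a i • b i := by
  simp [diagMap]

theorem diagMap_comp (a a' : Fin n → ℂ) :
    diagMap b a ∘ₗ diagMap b a' = diagMap b fun i => a i * a' i :=
  b.ext fun i => by simp [smul_smul, mul_comm]

theorem diagMap_one : diagMap b (fun _ => 1) = LinearMap.id :=
  b.ext fun i => by simp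

/-- The algebraic action of `ℂ*` on `V` that is diagonal in the basis `b` with weights `k`. -/
def diagAction : ℂˣ →* (V ≃ₗ[ℂ] V) where
  toFun c := LinearEquiv.ofLinearMap (diagMap b fun i => ((c ^ k i : ℂˣ) : ℂ))
    (diagMap b fun i => ((c⁻¹ ^ k i : ℂˣ) : ℂ))
    (by rw [diagMap_comp, ← diagMap_one b]; congr 1; funext i
        rw [← Units.val_mul, ← mul_zpow]; simp)
    (by rw [diagMap_comp, ← diagMap_one b]; congr 1; funext i
        rw [← Units.val_mul, ← mul_zpow]; simp)
  map_one' := by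
    apply LinearEquiv.toLinearMap_injective
    refine b.ext fun i => ?_
    simp
  map_mul' c c' := by
    apply LinearEquiv.toLinearMap_injective
    refine b.ext fun i => ?_
    simp [mul_zpow, smul_smul, mul_comm]

theorem diagAction_toLinearMap (c : ℂˣ) :
    (diagAction b k c).toLinearMap = diagMap b fun i => ((c ^ k i : ℂˣ) : ℂ) := rfl

theorem diagAction_basis (c : ℂˣ) (i : Fin n) :
    diagAction b k c (b i) = ((c ^ k i : ℂˣ) : ℂ) • b i :=
  diagMap_basis b _ i

@[simp]
theorem symMap_ι (φ : V →ₗ[ℂ] V) (v : V) :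
    symMap φ (SymmetricAlgebra.ι ℂ V v) = SymmetricAlgebra.ι ℂ V (φ v) := by
  simp [symMap]

theorem symMap_diagAction_symMonomial (c : ℂˣ) (α : Fin n →₀ ℕ) :
    symMap (diagAction b k c).toLinearMap (symMonomial b α) =
      ((c ^ Finsupp.weight k α : ℂˣ) : ℂ) • symMonomial b α := by
  induction α using Finsupp.induction_linear with
  | zero => simp [symMonomial_zero]
  | add α β hα hβ =>
    rw [symMonomial_add, map_mul, hα, hβ, map_add, zpow_add, smul_mul_smul_comm, Units.val_mul]
  | single i j =>
    rw [symMonomial_single, map_pow, symMap_ι, diagAction_toLinearMap, diagMap_basis, map_smul,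
      _root_.smul_pow, Finsupp.weight_single, ← Units.val_pow_eq_pow_val, ← zpow_natCast,
      ← zpow_mul, nsmul_eq_mul, mul_comm]

theorem coeff_symMap_diagAction (c : ℂˣ) (f : SymmetricAlgebra ℂ V) (α : Fin n →₀ ℕ) :
    (coordEquiv b (symMap (diagAction b k c).toLinearMap f)).coeff α =
      ((c ^ Finsupp.weight k α : ℂˣ) : ℂ) * (coordEquiv b f).coeff α := by
  classical
  induction f using sym_induction b with
  | add f g hf hg => simp only [map_add, MvPolynomial.coeff_add, hf, hg, mul_add]
  | monomial β a =>
    simp only [map_smul, symMap_diagAction_symMonomial, coordEquiv_symMonomial,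
      MvPolynomial.coeff_smul, MvPolynomial.coeff_monomial, smul_eq_mul]
    split_ifs with h
    · rw [h]; ring
    · simp

variable {I : Ideal (SymmetricAlgebra ℂ V)}

theorem coeff_transformPoly (φ : V ≃ₗ[ℂ] V) (c : ℂˣ) (F : (SymmetricAlgebra ℂ V)[X]) (j : ℕ) :
    (transformPoly φ c F).coeff j =
      ((c⁻¹ ^ j : ℂˣ) : ℂ) • symMap φ.toLinearMap (F.coeff j) := by
  rw [transformPoly, comp_C_mul_X_coeff, coeff_map, ← map_pow, mul_comm, ← Algebra.smul_def]
  simp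

/-- The total space is preserved by `ℂ*`: on the part of weight `m` the transformation is
multiplication by a constant. -/
theorem transformPoly_mem (c : ℂˣ) {F : (SymmetricAlgebra ℂ V)[X]}
    (hF : F ∈ degenerationIdeal b k I) :
    transformPoly (diagAction b k c) c F ∈ degenerationIdeal b k I := by
  rw [mem_degenerationIdeal] at hF ⊢
  intro m
  have : (laurentHom b k (transformPoly (diagAction b k c) c F)).coeff m =
      ((c ^ (-m) : ℂˣ) : ℂ) • (laurentHom b k F).coeff m := by
    apply (coordEquiv b).injective
    ext α
    rw [map_smul, MvPolynomial.coeff_smul, coeff_laurentHom, coeff_laurentHom]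
    split_ifs with h
    · rw [coeff_transformPoly, map_smul, MvPolynomial.coeff_smul, coeff_symMap_diagAction,
        smul_eq_mul, smul_eq_mul, ← mul_assoc, ← Units.val_mul]
      congr 2
      rw [inv_pow, ← zpow_natCast, ← zpow_neg, ← zpow_add, Int.toNat_of_nonneg h]
      congr 1
      ring
    · simp
  rw [this, Algebra.smul_def]
  exact I.mul_mem_left _ (hF m)

/-- Evaluation at `c` of the transform of `F` under `(φ, s ↦ c s)` is the transform of `F(1)`. -/
theorem eval_transformPoly (φ : V ≃ₗ[ℂ] V) (c c' : ℂˣ) (F : (SymmetricAlgebra ℂ V)[X]) :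
    (transformPoly φ c F).eval (algebraMap ℂ _ ((c * c' : ℂˣ) : ℂ)) =
      symMap φ.toLinearMap (F.eval (algebraMap ℂ _ (c' : ℂ))) := by
  rw [transformPoly, eval_comp, eval_mul, eval_C, eval_X, ← map_mul, ← Units.val_mul,
    inv_mul_cancel_left, eval_map, ← coe_evalRingHom, ← coe_eval₂RingHom]
  have h : (eval₂RingHom (symMap φ.toLinearMap : SymmetricAlgebra ℂ V →+* SymmetricAlgebra ℂ V)
      (algebraMap ℂ _ (c' : ℂ))) = (symMap φ.toLinearMap :
        SymmetricAlgebra ℂ V →+* SymmetricAlgebra ℂ V).comp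
          (evalRingHom (algebraMap ℂ (SymmetricAlgebra ℂ V) (c' : ℂ))) := by
    refine Polynomial.ringHom_ext' (RingHom.ext fun s => ?_) ?_
    · simp
    · simp
  rw [h]
  rfl

theorem symMap_symMap_symm (φ : V ≃ₗ[ℂ] V) (f : SymmetricAlgebra ℂ V) :
    symMap φ.toLinearMap (symMap φ.symm.toLinearMap f) = f := by
  have : (symMap φ.toLinearMap).comp (symMap φ.symm.toLinearMap) = AlgHom.id ℂ _ :=
    SymmetricAlgebra.algHom_ext (LinearMap.ext fun v => by simp)
  exact congrArg (fun g => g f) this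

theorem fiberIdeal_degenerationIdeal (c : ℂˣ) :
    fiberIdeal (degenerationIdeal b k I) c = I.map (symMap (diagAction b k c).toLinearMap :
      SymmetricAlgebra ℂ V →+* SymmetricAlgebra ℂ V) := by
  refine le_antisymm (fun f hf => ?_) (Ideal.map_le_iff_le_comap.2 fun f hf => ?_)
  · obtain ⟨F, hF, rfl⟩ := mem_fiberIdeal_iff.1 hf
    have h1 := transformPoly_mem b k c⁻¹ hF
    have h2 := eval_transformPoly (diagAction b k c⁻¹) c⁻¹ c F
    rw [inv_mul_cancel, Units.val_one, map_one, map_inv] at h2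
    rw [map_inv] at h1
    have h3 := eval_one_mem b k h1
    rw [h2] at h3
    rw [← symMap_symMap_symm (diagAction b k c) (F.eval _)]
    exact Ideal.mem_map_of_mem _ h3
  · rw [← fiberIdeal_one_degenerationIdeal b k (I := I), mem_fiberIdeal_iff] at hf
    obtain ⟨F, hF, rfl⟩ := hf
    rw [Ideal.mem_comap, mem_fiberIdeal_iff]
    refine ⟨_, transformPoly_mem b k c hF, ?_⟩
    have := eval_transformPoly (diagAction b k c) c 1 F
    rwa [mul_one, Units.val_one] at this

/-- The degeneration of the variety with ideal `I` generated by the diagonal `ℂ*`-action with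
weights `k`. -/
def diagDegeneration (hI : IsHomogeneousIdeal I) (hI' : I.IsPrime) : CStarDegeneration I where
  ideal := degenerationIdeal b k I
  homogeneous := degenerationIdeal_homogeneous b k hI
  isPrime := degenerationIdeal_isPrime b k hI'
  flat := degenerationIdeal_flat b k hI'
  action := diagAction b k
  algebraic := ⟨n, b, k, diagAction_basis b k⟩
  equivariant := fun c _ hF => transformPoly_mem b k c hF
  fiber_one := fiberIdeal_one_degenerationIdeal b k
  fiber_iso := fun c hc =>
    ⟨diagAction b k (Units.mk0 c hc), fiberIdeal_degenerationIdeal b k (Units.mk0 c hc)⟩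

theorem commute_diagMap_iff (a : Fin n → ℂ) (φ : V →ₗ[ℂ] V) :
    Commute (diagMap b a) φ ↔ ∀ i j, b.repr (φ (b j)) i ≠ 0 → a i = a j := by
  have hrepr : ∀ v i, b.repr (diagMap b a v) i = a i * b.repr v i := by
    intro v i
    have : (b.coord i) ∘ₗ diagMap b a = a i • b.coord i := b.ext fun j => by
      by_cases h : j = i <;> simp [h]
    exact LinearMap.congr_fun this v
  constructor
  · intro h i j hij
    have := congrArg (fun v => b.repr v i) (LinearMap.congr_fun h.eq (b j))
    simp only [Module.End.mul_apply, hrepr, diagMap_basis, map_smul, Finsupp.smul_apply,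
      smul_eq_mul] at this
    exact mul_right_cancel₀ hij this
  · intro h
    refine b.ext fun j => b.repr.injective (Finsupp.ext fun i => ?_)
    simp only [Module.End.mul_apply, hrepr, diagMap_basis, map_smul, Finsupp.smul_apply,
      smul_eq_mul]
    by_cases hij : b.repr (φ (b j)) i = 0
    · simp [hij]
    · rw [h i j hij]

theorem twist_ι_of_weight_eq (v : V) (m : ℤ) (h : ∀ i, b.repr v i ≠ 0 → k i = m) :
    twist b k (SymmetricAlgebra.ι ℂ V v) =
      LaurentPolynomial.C (SymmetricAlgebra.ι ℂ V v) * LaurentPolynomial.T (-m) := by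
  conv_lhs => rw [← b.sum_repr v]
  conv_rhs => rw [← b.sum_repr v]
  simp only [map_sum, map_smul, Finset.sum_mul, twist_ι]
  refine Finset.sum_congr rfl fun i _ => ?_
  by_cases hi : b.repr v i = 0
  · simp [hi]
  · rw [h i hi, Algebra.smul_def, Algebra.smul_def, map_mul, LaurentPolynomial.algebraMap_apply,
      mul_assoc]

/-- A linear automorphism that preserves the weight spaces and `X` preserves the total space. -/
theorem map_symMap_mem (φ : V →ₗ[ℂ] V) (hφ : ∀ i j, b.repr (φ (b j)) i ≠ 0 → k i = k j)
    (hφI : ∀ f ∈ I, symMap φ f ∈ I) {F : (SymmetricAlgebra ℂ V)[X]}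
    (hF : F ∈ degenerationIdeal b k I) :
    F.map (symMap φ : SymmetricAlgebra ℂ V →+* SymmetricAlgebra ℂ V) ∈
      degenerationIdeal b k I := by
  have h : (laurentHom b k).comp
      (mapRingHom (symMap φ : SymmetricAlgebra ℂ V →+* SymmetricAlgebra ℂ V)) =
      (AddMonoidAlgebra.mapRingHom ℤ (symMap φ : SymmetricAlgebra ℂ V →+* _)).comp
        (laurentHom b k) := by
    refine polynomial_sym_hom_ext b (fun c => ?_) (fun j => ?_) ?_
    · simp only [RingHom.comp_apply, coe_mapRingHom, map_C, laurentHom_C, AlgHom.commutes,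
        RingHom.coe_coe, LaurentPolynomial.algebraMap_apply, mapRingHom_laurent_C]
    · simp only [RingHom.comp_apply, coe_mapRingHom, map_C, laurentHom_C, RingHom.coe_coe,
        symMap_ι, twist_ι, map_mul, mapRingHom_laurent_C, mapRingHom_laurent_T]
      exact twist_ι_of_weight_eq b k _ _ fun i hi => hφ i j hi
    · simp only [RingHom.comp_apply, coe_mapRingHom, map_X, laurentHom_X, mapRingHom_laurent_T]
  rw [mem_degenerationIdeal] at hF ⊢
  intro m
  have := congrArg (fun g => (g F).coeff m) h
  simp only [RingHom.comp_apply, coe_mapRingHom, AddMonoidAlgebra.coeff_mapRingHom] at this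
  rw [this]
  exact hφI _ (hF m)

end Action

/-! ### Integrally closed subrings of a field -/

section IntegrallyClosedSubring

variable {F : Type*} [Field F]

theorem isIntegrallyClosed_subring_iff (Q : Subring F) :
    IsIntegrallyClosed Q ↔ ∀ a ∈ Q, ∀ b ∈ Q, b ≠ 0 → IsIntegral Q (a / b) → a / b ∈ Q := by
  have hinj : Function.Injective (algebraMap Q F) := Subtype.val_injective
  let j : FractionRing Q →ₐ[Q] F := IsFractionRing.liftAlgHom (g := Algebra.ofId Q F) hinj
  have hjmap : ∀ a : Q, j (algebraMap Q _ a) = a := fun a => j.commutes a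
  rw [isIntegrallyClosed_iff (FractionRing Q)]
  constructor
  · intro h a ha b hb _ hint
    have hx : j (algebraMap Q _ ⟨a, ha⟩ / algebraMap Q _ ⟨b, hb⟩) = a / b := by
      rw [map_div₀, hjmap, hjmap]
    rw [← hx, isIntegral_algHom_iff j j.toRingHom.injective] at hint
    obtain ⟨y, hy⟩ := h hint
    rw [← hx, ← hy, hjmap]
    exact y.2
  · intro h x hint
    obtain ⟨a, b, hb, rfl⟩ := IsFractionRing.div_surjective (A := Q) x
    rw [← isIntegral_algHom_iff j j.toRingHom.injective, map_div₀, hjmap, hjmap] at hint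
    have hb0 : (b : F) ≠ 0 := fun h0 => nonZeroDivisors.ne_zero hb (Subtype.ext h0)
    refine ⟨⟨_, h a a.2 b b.2 hb0 hint⟩, j.toRingHom.injective ?_⟩
    change j _ = j _
    rw [hjmap, map_div₀, hjmap, hjmap]

/-- The elements of `F` that are multiplied into the subring `Q` by a power of `w ∈ Q`. -/
def clearing (Q : Subring F) (w : F) (hw : w ∈ Q) : Subring F where
  carrier := {a | ∃ D : ℕ, w ^ D * a ∈ Q}
  mul_mem' := by
    rintro a b ⟨D, hD⟩ ⟨E, hE⟩
    refine ⟨D + E, ?_⟩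
    rw [pow_add, mul_mul_mul_comm]
    exact Q.mul_mem hD hE
  one_mem' := ⟨0, by simp⟩
  add_mem' := by
    rintro a b ⟨D, hD⟩ ⟨E, hE⟩
    refine ⟨D + E, ?_⟩
    have : w ^ (D + E) * (a + b) = w ^ E * (w ^ D * a) + w ^ D * (w ^ E * b) := by ring
    rw [this]
    exact Q.add_mem (Q.mul_mem (Q.pow_mem hw _) hD) (Q.mul_mem (Q.pow_mem hw _) hE)
  zero_mem' := ⟨0, by simp⟩
  neg_mem' := by
    rintro a ⟨D, hD⟩
    exact ⟨D, by rw [mul_neg]; exact Q.neg_mem hD⟩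

theorem mem_clearing {Q : Subring F} {w : F} {hw : w ∈ Q} {a : F} :
    a ∈ clearing Q w hw ↔ ∃ D : ℕ, w ^ D * a ∈ Q := Iff.rfl

theorem pow_mul_mem_of_le {Q : Subring F} {w : F} (hw : w ∈ Q) {a : F} {D E : ℕ} (h : D ≤ E)
    (ha : w ^ D * a ∈ Q) : w ^ E * a ∈ Q := by
  obtain ⟨m, rfl⟩ := Nat.exists_eq_add_of_le h
  rw [add_comm, pow_add, mul_assoc]
  exact Q.mul_mem (Q.pow_mem hw _) ha

/-- If `R` lies in `Q[w⁻¹]` with `Q` integrally closed, then an element of the fraction field of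
`R` that is integral over `R` lies in `Q[w⁻¹]`. -/
theorem mem_clearing_of_isIntegral {Q R : Subring F} [hQ : IsIntegrallyClosed Q] {w : F}
    (hw : w ∈ Q) (hw0 : w ≠ 0) (hR : R ≤ clearing Q w hw) {a b : F} (ha : a ∈ R) (hb : b ∈ R)
    (hb0 : b ≠ 0) (hy : IsIntegral R (a / b)) : a / b ∈ clearing Q w hw := by
  classical
  obtain ⟨p, hp, hpy⟩ := hy
  set q := p.map (algebraMap R F) with hq
  have hqm : q.Monic := hp.map _
  choose! D hD using fun x (hx : x ∈ R) => mem_clearing.1 (hR hx)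
  obtain ⟨E, hE⟩ := (insert a (insert b q.coeffs) |>.image D).bddAbove
  have hcoeff : ∀ i, q.coeff i ∈ R := fun i => by
    rw [hq, coeff_map]; exact (p.coeff i).2
  have hle : ∀ x ∈ insert a (insert b q.coeffs), D x ≤ E := fun x hx =>
    hE (Finset.mem_image_of_mem _ hx)
  have haE : w ^ E * a ∈ Q := pow_mul_mem_of_le hw (hle a (by simp)) (hD a ha)
  have hbE : w ^ E * b ∈ Q := pow_mul_mem_of_le hw (hle b (by simp)) (hD b hb)
  have hcE : ∀ i, w ^ E * q.coeff i ∈ Q := fun i => by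
    by_cases h0 : q.coeff i = 0
    · rw [h0, mul_zero]; exact Q.zero_mem
    · refine pow_mul_mem_of_le hw (hle _ ?_) (hD _ (hcoeff i))
      simp only [Finset.mem_insert]
      exact Or.inr (Or.inr (coeff_mem_coeffs h0))
  -- the polynomial whose roots are those of `q`, multiplied by `w ^ E`
  have hlift : scaleRoots q (w ^ E) ∈ lifts (algebraMap Q F) := by
    rw [lifts_iff_coeff_lifts]
    intro i
    suffices (scaleRoots q (w ^ E)).coeff i ∈ Q from ⟨⟨_, this⟩, rfl⟩
    rw [coeff_scaleRoots]
    rcases lt_trichotomy i q.natDegree with h | h | h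
    · obtain ⟨m, hm⟩ := Nat.exists_eq_add_of_lt h
      have : q.natDegree - i = m + 1 := by omega
      rw [this, pow_succ', ← mul_assoc, mul_comm (q.coeff i)]
      exact Q.mul_mem (hcE i) (Q.pow_mem (Q.pow_mem hw _) _)
    · rw [h, hqm.coeff_natDegree, Nat.sub_self, pow_zero, one_mul]; exact Q.one_mem
    · rw [coeff_eq_zero_of_natDegree_lt h, zero_mul]; exact Q.zero_mem
  obtain ⟨r, hr, -, hrm⟩ := lifts_and_natDegree_eq_and_monic hlift
    ((monic_scaleRoots_iff _).2 hqm)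
  have hint : IsIntegral Q (w ^ E * (a / b)) := by
    refine ⟨r, hrm, ?_⟩
    rw [← eval_map, hr, ← eval₂_id]
    refine scaleRoots_eval₂_eq_zero (RingHom.id F) ?_
    rwa [eval₂_id, hq, eval_map]
  have hfrac : w ^ E * (a / b) = (w ^ E * (w ^ E * a)) / (w ^ E * b) := by
    rw [mul_div_mul_left _ _ (pow_ne_zero _ hw0), mul_div_assoc]
  refine ⟨E, ?_⟩
  rw [hfrac] at hint ⊢
  exact (isIntegrallyClosed_subring_iff Q).1 hQ _ (Q.mul_mem (Q.pow_mem hw _) haE) _ hbE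
    (mul_ne_zero (pow_ne_zero _ hw0) hb0) hint

/-- If the ideal `t R` is radical, then an element `y` integral over `R` with `t y ∈ R` lies
in `R`. -/
theorem mem_of_mul_mem_of_isIntegral {R : Subring F} {t : R} (ht : t ≠ 0)
    (hrad : (Ideal.span {t}).IsRadical) {y : F} (hy : IsIntegral R y) (hty : (t : F) * y ∈ R) :
    y ∈ R := by
  obtain ⟨p, hp, hpy⟩ := hy
  set a : R := ⟨t * y, hty⟩ with ha
  have h0 : (scaleRoots p t).eval a = 0 := by
    have h1 : eval₂ (algebraMap R F) ((algebraMap R F t) * y) (scaleRoots p t) = 0 :=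
      scaleRoots_eval₂_eq_zero _ hpy
    apply (Subtype.val_injective : Function.Injective (algebraMap R F))
    exact (eval₂_at_apply (algebraMap R F) a).symm.trans h1
  have h2 : a ^ p.natDegree ∈ Ideal.span {t} := by
    rw [eval_eq_sum_range, natDegree_scaleRoots, Finset.sum_range_succ, coeff_scaleRoots,
      Nat.sub_self, pow_zero, mul_one, hp.coeff_natDegree, one_mul] at h0
    rw [eq_neg_of_add_eq_zero_right h0, Ideal.neg_mem_iff]
    refine Ideal.sum_mem _ fun i hi => ?_
    rw [coeff_scaleRoots, mul_right_comm]
    refine Ideal.mul_mem_left _ _ (Ideal.pow_mem_of_mem _ (Ideal.mem_span_singleton_self t) _ ?_)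
    have := Finset.mem_range.1 hi
    omega
  obtain ⟨c, hc⟩ := Ideal.mem_span_singleton.1 (hrad ⟨_, h2⟩)
  have h3 : (t : F) * y = t * c := congrArg Subtype.val hc
  have ht' : (t : F) ≠ 0 := fun h => ht (Subtype.ext h)
  rw [mul_left_cancel₀ ht' h3]
  exact c.2

theorem mem_of_pow_mul_mem_of_isIntegral {R : Subring F} {t : R} (ht : t ≠ 0)
    (hrad : (Ideal.span {t}).IsRadical) {y : F} (hy : IsIntegral R y) (m : ℕ)
    (hty : (t : F) ^ m * y ∈ R) : y ∈ R := by
  induction m with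
  | zero => simpa using hty
  | succ m ih =>
    refine ih (mem_of_mul_mem_of_isIntegral ht hrad ?_ ?_)
    · exact (isIntegral_algebraMap (R := R) (A := F) (x := t)).pow m |>.mul hy
    · rwa [← mul_assoc, ← pow_succ']

/-- If elements `s i` generate the unit ideal of `R` and `y` lies in `R` after multiplication by
powers of each `s i` and of `t`, then a power of `t` multiplies `y` into `R`. -/
theorem exists_pow_mul_mem_of_cover {R : Subring F} {t : R} {ι : Type*} [Fintype ι] (s c : ι → R)
    (hs : ∑ i, c i * s i = 1) {y : F}
    (hy : ∀ i, ∃ M E : ℕ, (t : F) ^ M * (s i : F) ^ E * y ∈ R) :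
    ∃ M : ℕ, (t : F) ^ M * y ∈ R := by
  let 𝔞 : Ideal R :=
    { carrier := {r | ∃ M : ℕ, (t : F) ^ M * ((r : F) * y) ∈ R}
      add_mem' := by
        rintro a b ⟨D, hD⟩ ⟨E, hE⟩
        refine ⟨D + E, ?_⟩
        have : (t : F) ^ (D + E) * (((a + b : R) : F) * y) =
            (t : F) ^ E * ((t : F) ^ D * ((a : F) * y)) +
              (t : F) ^ D * ((t : F) ^ E * ((b : F) * y)) := by
          push_cast; ring
        rw [this]
        exact R.add_mem (R.mul_mem (R.pow_mem t.2 _) hD) (R.mul_mem (R.pow_mem t.2 _) hE)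
      zero_mem' := ⟨0, by simp⟩
      smul_mem' := by
        rintro r a ⟨D, hD⟩
        refine ⟨D, ?_⟩
        have : (t : F) ^ D * (((r • a : R) : F) * y) = (r : F) * ((t : F) ^ D * ((a : F) * y)) := by
          simp only [smul_eq_mul, Subring.coe_mul]; ring
        rw [this]
        exact R.mul_mem r.2 hD }
  have h1 : (1 : R) ∈ 𝔞.radical := by
    rw [← hs]
    refine Ideal.sum_mem _ fun i _ => Ideal.mul_mem_left _ _ ?_
    obtain ⟨M, E, h⟩ := hy i
    exact ⟨E, M, by push_cast; rwa [← mul_assoc]⟩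
  obtain ⟨m, hm⟩ := h1
  rw [one_pow] at hm
  obtain ⟨M, hM⟩ := hm
  exact ⟨M, by simpa using hM⟩

end IntegrallyClosedSubring

/-! ### Affine charts as subrings of a field -/

section Charts

variable {V : Type*} [AddCommGroup V] [Module ℂ V] {F : Type*} [Field F] [Algebra ℂ F]

/-- The homomorphism `(Sym V)[X] → F` that extends a linear map `z : V → F` and sends `X` to `t`. -/
def chartHom (z : V →ₗ[ℂ] F) (t : F) : (SymmetricAlgebra ℂ V)[X] →+* F :=
  eval₂RingHom (SymmetricAlgebra.lift z : SymmetricAlgebra ℂ V →+* F) t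

@[simp]
theorem chartHom_C_ι (z : V →ₗ[ℂ] F) (t : F) (v : V) :
    chartHom z t (C (SymmetricAlgebra.ι ℂ V v)) = z v := by
  simp [chartHom]

@[simp]
theorem chartHom_C_algebraMap (z : V →ₗ[ℂ] F) (t : F) (c : ℂ) :
    chartHom z t (C (algebraMap ℂ _ c)) = algebraMap ℂ F c := by
  simp [chartHom]

@[simp]
theorem chartHom_X (z : V →ₗ[ℂ] F) (t : F) : chartHom z t X = t := by
  simp [chartHom]

/-- The product of a linear map `V → F` with a scalar in `F`. -/
abbrev scaleForm (u : F) (z : V →ₗ[ℂ] F) : V →ₗ[ℂ] F :=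
  LinearMap.mulLeft ℂ u ∘ₗ z

theorem lift_scaleForm (u : F) (z : V →ₗ[ℂ] F) {d : ℕ} {f : SymmetricAlgebra ℂ V}
    (hf : f ∈ symPower V d) :
    SymmetricAlgebra.lift (scaleForm u z) f = u ^ d * SymmetricAlgebra.lift z f := by
  refine Submodule.pow_induction_on_left' (LinearMap.range (SymmetricAlgebra.ι ℂ V))
    (C := fun d f _ => SymmetricAlgebra.lift (scaleForm u z) f =
      u ^ d * SymmetricAlgebra.lift z f) ?_ ?_ ?_ hf
  · intro r
    simp
  · intro x y i _ _ hx hy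
    rw [map_add, map_add, hx, hy, mul_add]
  · rintro _ ⟨v, rfl⟩ i x _ hx
    rw [map_mul, map_mul, hx, SymmetricAlgebra.lift_ι_apply, SymmetricAlgebra.lift_ι_apply]
    simp only [LinearMap.comp_apply, LinearMap.mulLeft_apply, Nat.succ_eq_add_one]
    ring

theorem chartHom_scaleForm (u : F) (z : V →ₗ[ℂ] F) (t : F) {d : ℕ}
    {G : (SymmetricAlgebra ℂ V)[X]} (hG : ∀ j, G.coeff j ∈ symPower V d) :
    chartHom (scaleForm u z) t G = u ^ d * chartHom z t G := by
  simp only [chartHom, coe_eval₂RingHom, eval₂_eq_sum_range, Finset.mul_sum, RingHom.coe_coe]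
  refine Finset.sum_congr rfl fun j _ => ?_
  rw [lift_scaleForm u z (hG j), mul_assoc]

theorem chartHom_range_le {n : ℕ} (b : Module.Basis (Fin n) ℂ V) (z : V →ₗ[ℂ] F) (t : F)
    (Q : Subring F) (hc : ∀ c : ℂ, algebraMap ℂ F c ∈ Q) (hz : ∀ i, z (b i) ∈ Q) (ht : t ∈ Q) :
    (chartHom z t).range ≤ Q := by
  rintro _ ⟨G, rfl⟩
  induction G using polynomial_sym_induction b with
  | add F G hF hG => rw [map_add]; exact Q.add_mem hF hG
  | mono j α c =>
    rw [← C_mul_X_pow_eq_monomial, map_mul, map_pow, chartHom_X, Algebra.smul_def, C_mul, map_mul,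
      chartHom_C_algebraMap]
    refine Q.mul_mem (Q.mul_mem (hc c) ?_) (Q.pow_mem ht j)
    induction α using Finsupp.induction_linear with
    | zero => rw [symMonomial_zero, C_1, map_one]; exact Q.one_mem
    | add α β hα hβ => rw [symMonomial_add, C_mul, map_mul]; exact Q.mul_mem hα hβ
    | single i j =>
      rw [symMonomial_single, C_pow, map_pow, chartHom_C_ι]
      exact Q.pow_mem (hz i) j

/-- Dehomogenization: if `J` is the kernel of the homomorphism given by `z`, then the chart
`{v = 1}` of the scheme defined by `J` is the ring generated by the `z(w) / z(v)`. -/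
theorem ker_chartHom_scaleForm {n : ℕ} (b : Module.Basis (Fin n) ℂ V) (z : V →ₗ[ℂ] F) (t : F)
    {J : Ideal (SymmetricAlgebra ℂ V)[X]} (hJ : RingHom.ker (chartHom z t) = J)
    (hhom : J = Ideal.span {G | G ∈ J ∧ ∃ d, ∀ j, G.coeff j ∈ symPower V d})
    {v : V} (hv : z v ≠ 0) :
    RingHom.ker (chartHom (scaleForm (z v)⁻¹ z) t) =
      J ⊔ Ideal.span {C (SymmetricAlgebra.ι ℂ V v) - 1} := by
  refine le_antisymm (fun G hG => ?_) (sup_le ?_ ?_)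
  · obtain ⟨D, hD⟩ := exists_sum_polyComponent b G
    have hcomp : ∀ d, chartHom (scaleForm (z v)⁻¹ z) t (polyComponent b d G) =
        (z v)⁻¹ ^ d * chartHom z t (polyComponent b d G) := fun d =>
      chartHom_scaleForm _ z t fun j => by
        rw [coeff_polyComponent]; exact symComponent_mem b d _
    -- the homogenization of `G` by means of `v`
    set H := ∑ d ∈ Finset.range D, C (SymmetricAlgebra.ι ℂ V v) ^ (D - d) * polyComponent b d G
      with hH
    have hHJ : H ∈ J := by
      rw [← hJ, RingHom.mem_ker, hH, map_sum]
      rw [RingHom.mem_ker, hD, map_sum] at hG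
      calc _ = ∑ d ∈ Finset.range D, z v ^ D *
            chartHom (scaleForm (z v)⁻¹ z) t (polyComponent b d G) := by
            refine Finset.sum_congr rfl fun d hd => ?_
            have hle : d ≤ D := (Finset.mem_range.1 hd).le
            rw [hcomp, map_mul, map_pow, chartHom_C_ι, ← mul_assoc, inv_pow, ← pow_sub₀ _ hv hle]
        _ = 0 := by rw [← Finset.mul_sum, hG, mul_zero]
    have hsub : H - G ∈ Ideal.span {C (SymmetricAlgebra.ι ℂ V v) - 1} := by
      rw [congrArg (H - ·) hD, hH, ← Finset.sum_sub_distrib]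
      refine Ideal.sum_mem _ fun d _ => ?_
      rw [← sub_one_mul]
      refine Ideal.mul_mem_right _ _ (Ideal.mem_span_singleton.2 ?_)
      simpa using sub_dvd_pow_sub_pow (C (SymmetricAlgebra.ι ℂ V v)) 1 (D - d)
    have : G = H - (H - G) := by ring
    rw [this]
    exact Ideal.sub_mem _ (Ideal.mem_sup_left hHJ) (Ideal.mem_sup_right hsub)
  · rw [hhom]
    refine Ideal.span_le.2 ?_
    rintro G ⟨hG, d, hd⟩
    rw [← hJ, RingHom.mem_ker] at hG
    rw [SetLike.mem_coe, RingHom.mem_ker, chartHom_scaleForm _ z t hd, hG, mul_zero]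
  · rw [Ideal.span_singleton_le_iff_mem, RingHom.mem_ker, map_sub, chartHom_C_ι, map_one,
      LinearMap.comp_apply, LinearMap.mulLeft_apply, inv_mul_cancel₀ hv, sub_self]

end Charts

/-! ### Normality of the total space -/

section Normality

variable {V : Type*} [AddCommGroup V] [Module ℂ V] {F : Type*} [Field F] [Algebra ℂ F]
  {n : ℕ} (b : Module.Basis (Fin n) ℂ V) (k : Fin n → ℤ)

/-- The linear map `V → F` given by `bᵢ ↦ t ^ (-kᵢ) xᵢ`. -/
def twistedForm (x : Fin n → F) (t : F) (k : Fin n → ℤ) : V →ₗ[ℂ] F :=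
  b.constr ℂ fun i => t ^ (-k i) * x i

@[simp]
theorem twistedForm_basis (x : Fin n → F) (t : F) (i : Fin n) :
    twistedForm b x t k (b i) = t ^ (-k i) * x i := by
  simp [twistedForm]

theorem degenerationIdeal_zero (I : Ideal (SymmetricAlgebra ℂ V)) :
    degenerationIdeal b 0 I = I.map C := by
  ext G
  rw [Ideal.mem_map_C_iff, mem_degenerationIdeal]
  have h : ∀ m, (laurentHom b 0 G).coeff m = if 0 ≤ m then G.coeff m.toNat else 0 := by
    intro m
    apply (coordEquiv b).injective
    ext α
    rw [coeff_laurentHom]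
    have : Finsupp.weight (0 : Fin n → ℤ) α = 0 := by
      simp [Finsupp.weight_apply]
    rw [this, add_zero]
    split_ifs <;> simp
  constructor
  · intro hG j
    have := hG j
    rwa [h, if_pos (by omega), Int.toNat_natCast] at this
  · intro hG m
    rw [h]
    split_ifs
    · exact hG _
    · exact I.zero_mem

variable {I : Ideal (SymmetricAlgebra ℂ V)}

/-- The charts of the trivial degeneration `X × ℂ` are normal. -/
theorem isIntegrallyClosed_trivial_chart (hI : IsNormalProjectiveVariety I) (x : Fin n → F)
    (t : F) (hker : RingHom.ker (chartHom (twistedForm b x t 0) t) = degenerationIdeal b 0 I)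
    {i : Fin n} (hi : x i ≠ 0) :
    IsIntegrallyClosed (chartHom (scaleForm (x i)⁻¹ (twistedForm b x t 0)) t).range := by
  have hz : twistedForm b x t 0 (b i) = x i := by simp
  have hιI : SymmetricAlgebra.ι ℂ V (b i) ∉ I := by
    intro h
    have : C (SymmetricAlgebra.ι ℂ V (b i)) ∈ degenerationIdeal b 0 I := by
      rw [degenerationIdeal_zero]; exact Ideal.mem_map_of_mem _ h
    rw [← hker, RingHom.mem_ker, chartHom_C_ι, hz] at this
    exact hi this
  set I₁ := I ⊔ Ideal.span {SymmetricAlgebra.ι ℂ V (b i) - 1} with hI₁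
  have hk := ker_chartHom_scaleForm b (twistedForm b x t 0) t hker
    (degenerationIdeal_homogeneous b 0 hI.homogeneous) (v := b i) (by rwa [hz])
  rw [hz] at hk
  have hk' : RingHom.ker (chartHom (scaleForm (x i)⁻¹ (twistedForm b x t 0)) t) = I₁.map C := by
    rw [hk, hI₁, Ideal.map_sup, Ideal.map_span, Set.image_singleton, map_sub, map_one,
      degenerationIdeal_zero]
  let e : (SymmetricAlgebra ℂ V ⧸ I₁)[X] ≃+*
      (chartHom (scaleForm (x i)⁻¹ (twistedForm b x t 0)) t).range :=
    (Ideal.polynomialQuotientEquivQuotientPolynomial I₁).trans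
      ((Ideal.quotEquivOfEq hk'.symm).trans (RingHom.quotientKerEquivRange _))
  have : IsIntegrallyClosed (SymmetricAlgebra ℂ V ⧸ I₁) := hI.normal (b i) hιI
  have hdom : IsDomain (SymmetricAlgebra ℂ V ⧸ I₁)[X] := e.toMulEquiv.isDomain _
  have : IsDomain (SymmetricAlgebra ℂ V ⧸ I₁) := (C_injective).isDomain C
  exact IsIntegrallyClosed.of_equiv (R := (SymmetricAlgebra ℂ V ⧸ I₁)[X]) e

/-- Away from the central fiber the total space is locally isomorphic to a trivial family, so an
element of the fraction field of a chart `{v = 1}` that is integral over the chart lies in the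
chart up to a power of `t`. -/
theorem exists_pow_mul_mem_chart (hI : IsNormalProjectiveVariety I) (x : Fin n → F) {t : F}
    (ht : t ≠ 0)
    (hker : RingHom.ker (chartHom (twistedForm b x t 0) t) = degenerationIdeal b 0 I)
    {v : V} (hv : twistedForm b x t k v ≠ 0) {R : Subring F}
    (hR : R = (chartHom (scaleForm (twistedForm b x t k v)⁻¹ (twistedForm b x t k)) t).range)
    {y₁ y₂ : F} (hy₁ : y₁ ∈ R) (hy₂ : y₂ ∈ R) (hy₀ : y₂ ≠ 0) (hy : IsIntegral R (y₁ / y₂)) :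
    ∃ M : ℕ, t ^ M * (y₁ / y₂) ∈ R := by
  set z := twistedForm b x t k with hz
  set y := y₁ / y₂ with hy_def
  have htR : t ∈ R := by rw [hR]; exact ⟨X, chartHom_X _ _⟩
  have hcR : ∀ c : ℂ, algebraMap ℂ F c ∈ R := fun c => by
    rw [hR]; exact ⟨_, chartHom_C_algebraMap _ _ c⟩
  have hsR : ∀ i, z (b i) / z v ∈ R := fun i => by
    rw [hR]
    exact ⟨_, (chartHom_C_ι _ _ (b i)).trans (by simp [div_eq_inv_mul])⟩
  -- a bound for the absolute values of the weights
  obtain ⟨K, hK⟩ : ∃ K : ℕ, ∀ i, |k i| ≤ K :=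
    ⟨∑ i, (k i).natAbs, fun i => by
      rw [Int.abs_eq_natAbs]
      exact_mod_cast Finset.single_le_sum (f := fun i => (k i).natAbs) (fun _ _ => Nat.zero_le _)
        (Finset.mem_univ i)⟩
  have hKnat : ∀ m : ℤ, |m| ≤ K → ∃ l : ℕ, t ^ K * t ^ m = t ^ l := fun m hm => by
    refine ⟨((K : ℤ) + m).toNat, ?_⟩
    rw [← zpow_natCast, ← zpow_natCast, ← zpow_add₀ ht, Int.toNat_of_nonneg]
    have := abs_le.1 hm
    omega
  have hlocal : ∀ i, ∃ M E : ℕ, t ^ M * (z (b i) / z v) ^ E * y ∈ R := by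
    intro i
    by_cases hi : x i = 0
    · exact ⟨0, 1, by simp [hz, hi]⟩
    set z₀ := twistedForm b x t 0 with hz₀
    set Q := (chartHom (scaleForm (x i)⁻¹ z₀) t).range with hQ
    have hQclosed : IsIntegrallyClosed Q := isIntegrallyClosed_trivial_chart b hI x t hker hi
    have htQ : t ∈ Q := ⟨X, chartHom_X _ _⟩
    have hcQ : ∀ c : ℂ, algebraMap ℂ F c ∈ Q := fun c => ⟨_, chartHom_C_algebraMap _ _ c⟩
    have hsQ : ∀ j, x j / x i ∈ Q := fun j =>
      ⟨_, (chartHom_C_ι _ _ (b j)).trans (by simp [hz₀, div_eq_inv_mul])⟩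
    have hzQ : ∀ j, t ^ K * z (b j) / x i ∈ Q := fun j => by
      obtain ⟨l, hl⟩ := hKnat (-k j) (by rw [abs_neg]; exact hK j)
      have : t ^ K * z (b j) / x i = t ^ l * (x j / x i) := by
        rw [← hl, hz, twistedForm_basis]; ring
      rw [this]
      exact Q.mul_mem (Q.pow_mem htQ _) (hsQ j)
    -- `w` and `w'` are, up to powers of `t`, the transition functions between the two charts
    set w := t ^ K * z v / x i with hw
    set w' := t ^ K * x i / z v with hw'
    have hwQ : w ∈ Q := by
      have : w = ∑ j, algebraMap ℂ F (b.repr v j) * (t ^ K * z (b j) / x i) := by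
        rw [hw]
        conv_lhs => rw [← b.sum_repr v]
        simp only [map_sum, map_smul, Finset.mul_sum, Finset.sum_div, Algebra.smul_def]
        exact Finset.sum_congr rfl fun j _ => by ring
      rw [this]
      exact Q.sum_mem fun j _ => Q.mul_mem (hcQ _) (hzQ j)
    have hw0 : w ≠ 0 := div_ne_zero (mul_ne_zero (pow_ne_zero _ ht) hv) hi
    have hRle : R ≤ clearing Q w hwQ := by
      rw [hR]
      refine chartHom_range_le b _ t _ (fun c => ⟨0, by simpa using hcQ c⟩) (fun j => ⟨1, ?_⟩)
        ⟨0, by simpa using htQ⟩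
      have : w ^ 1 * (scaleForm (z v)⁻¹ z) (b j) = t ^ K * z (b j) / x i := by
        simp only [LinearMap.comp_apply, LinearMap.mulLeft_apply, hw]
        field_simp
      rw [this]
      exact hzQ j
    have hw'i : ∃ l : ℕ, w' = t ^ l * (z (b i) / z v) := by
      obtain ⟨l, hl⟩ := hKnat (k i) (hK i)
      refine ⟨l, ?_⟩
      rw [← hl, hz, twistedForm_basis, hw', mul_assoc, ← mul_div_assoc, ← mul_assoc (t ^ k i),
        ← zpow_add₀ ht, add_neg_cancel, zpow_zero, one_mul, mul_div_assoc]
    obtain ⟨l, hl⟩ := hw'i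
    have hw'R : w' ∈ R := by
      rw [hl]; exact R.mul_mem (R.pow_mem htR _) (hsR i)
    have hQle : Q ≤ clearing R w' hw'R := by
      refine chartHom_range_le b _ t _ (fun c => ⟨0, by simpa using hcR c⟩) (fun j => ⟨1, ?_⟩)
        ⟨0, by simpa using htR⟩
      obtain ⟨m, hm⟩ := hKnat (k j) (hK j)
      have : w' ^ 1 * (scaleForm (x i)⁻¹ z₀) (b j) = t ^ m * (z (b j) / z v) := by
        simp only [LinearMap.comp_apply, LinearMap.mulLeft_apply, hw', hz₀, twistedForm_basis,
          Pi.zero_apply, neg_zero, zpow_zero, one_mul, pow_one]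
        rw [← hm, show z (b j) = t ^ (-k j) * x j from twistedForm_basis b k x t j, zpow_neg]
        field_simp
      rw [this]
      exact R.mul_mem (R.pow_mem htR _) (hsR j)
    obtain ⟨D, hD⟩ := mem_clearing.1
      (mem_clearing_of_isIntegral hwQ hw0 hRle hy₁ hy₂ hy₀ hy)
    obtain ⟨E, hE⟩ := mem_clearing.1 (hQle hD)
    refine ⟨2 * K * D + l * E, E, ?_⟩
    have hww' : w' * w = t ^ (2 * K) := by
      rw [hw, hw']; field_simp; ring
    have : t ^ (2 * K * D + l * E) * (z (b i) / z v) ^ E * y =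
        w' ^ D * (w' ^ E * (w ^ D * y)) := by
      have h1 : w' ^ E = t ^ (l * E) * (z (b i) / z v) ^ E := by
        rw [hl, mul_pow, ← pow_mul]
      calc _ = (t ^ (2 * K)) ^ D * (t ^ (l * E) * (z (b i) / z v) ^ E) * y := by
            rw [pow_add, ← pow_mul]; ring
        _ = _ := by rw [← hww', ← h1, mul_pow]; ring
    rw [this]
    exact R.mul_mem (R.pow_mem hw'R _) hE
  refine exists_pow_mul_mem_of_cover (R := R) (t := ⟨t, htR⟩) (fun i => ⟨_, hsR i⟩)
    (fun i => ⟨_, hcR (b.repr v i)⟩) (Subtype.ext ?_) hlocal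
  have : ∑ i, algebraMap ℂ F (b.repr v i) * (z (b i) / z v) = 1 := by
    have h := congrArg z (b.sum_repr v)
    simp only [map_sum, map_smul, Algebra.smul_def] at h
    simp only [← mul_div_assoc]
    rw [← Finset.sum_div, h, div_self hv]
  simpa using this

end Normality

section NormalTotalSpace

/-- If the fiber of `R = A[X] ⧸ K` over `X = 0` is reduced, then `X R` is a radical ideal. -/
theorem isRadical_span_X {A F : Type*} [CommRing A] [Field F] (φ : A[X] →+* F)
    (hred : IsReduced (A ⧸ (RingHom.ker φ).map (evalRingHom 0))) :
    (Ideal.span {(⟨φ X, X, rfl⟩ : φ.range)}).IsRadical := by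
  rw [← Ideal.isRadical_iff_quotient_reduced] at hred
  rintro ⟨_, G, rfl⟩ ⟨m, hm⟩
  obtain ⟨⟨_, H, rfl⟩, hH⟩ := Ideal.mem_span_singleton.1 hm
  have hker : G ^ m - X * H ∈ RingHom.ker φ := by
    rw [RingHom.mem_ker, map_sub, map_pow, map_mul, sub_eq_zero]
    exact congrArg Subtype.val hH
  have h0 : G.eval 0 ^ m ∈ (RingHom.ker φ).map (evalRingHom 0) := by
    simpa using Ideal.mem_map_of_mem (evalRingHom 0) hker
  obtain ⟨P, hP, hPG⟩ := (Ideal.mem_map_iff_of_surjective _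
    fun a => ⟨C a, by simp⟩).1 (hred ⟨m, h0⟩)
  obtain ⟨H', hH'⟩ : X ∣ G - P := by
    rw [X_dvd_iff, coeff_zero_eq_eval_zero, eval_sub, ← hPG, coe_evalRingHom, sub_self]
  refine Ideal.mem_span_singleton.2 ⟨⟨_, H', rfl⟩, Subtype.ext ?_⟩
  have := congrArg φ hH'
  rwa [map_sub, RingHom.mem_ker.1 hP, sub_zero, map_mul] at this

variable {V : Type*} [AddCommGroup V] [Module ℂ V] {n : ℕ} (b : Module.Basis (Fin n) ℂ V)
  (k : Fin n → ℤ) {I : Ideal (SymmetricAlgebra ℂ V)}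

/-- For all weights `k` the degeneration ideals are kernels of homomorphisms into one and the same
field, which contains the Laurent polynomials over the cone of `X`. -/
theorem ker_chartHom_twistedForm {F : Type*} [Field F] [Algebra ℂ F]
    (j : LaurentPolynomial (SymmetricAlgebra ℂ V ⧸ I) →+* F) (hj : Function.Injective j)
    (hjc : ∀ c : ℂ, j (LaurentPolynomial.C (algebraMap ℂ _ c)) = algebraMap ℂ F c) :
    RingHom.ker (chartHom (twistedForm b (fun i => j (LaurentPolynomial.C
      (Ideal.Quotient.mk I (SymmetricAlgebra.ι ℂ V (b i))))) (j (LaurentPolynomial.T 1)) k)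
        (j (LaurentPolynomial.T 1))) = degenerationIdeal b k I := by
  have hT : ∀ m : ℤ, j (LaurentPolynomial.T m) = j (LaurentPolynomial.T 1) ^ m := by
    have hnat : ∀ m : ℕ, j (LaurentPolynomial.T m) = j (LaurentPolynomial.T 1) ^ m := fun m => by
      rw [← map_pow, LaurentPolynomial.T_pow, mul_one]
    intro m
    obtain ⟨m, rfl | rfl⟩ := m.eq_nat_or_neg
    · rw [hnat, zpow_natCast]
    · rw [zpow_neg, zpow_natCast, ← hnat]
      refine eq_inv_of_mul_eq_one_left ?_
      rw [← map_mul, ← LaurentPolynomial.T_add, neg_add_cancel, LaurentPolynomial.T_zero, map_one]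
  have h : chartHom (twistedForm b (fun i => j (LaurentPolynomial.C
      (Ideal.Quotient.mk I (SymmetricAlgebra.ι ℂ V (b i))))) (j (LaurentPolynomial.T 1)) k)
        (j (LaurentPolynomial.T 1)) = j.comp (degenerationHom b k I) := by
    refine polynomial_sym_hom_ext b (fun c => ?_) (fun i => ?_) ?_
    · rw [chartHom_C_algebraMap, RingHom.comp_apply, degenerationHom_algebraMap, hjc]
    · rw [chartHom_C_ι, twistedForm_basis, RingHom.comp_apply, degenerationHom_ι, map_mul,
        hT (-k i), mul_comm]
    · rw [chartHom_X, RingHom.comp_apply, degenerationHom_X]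
  rw [h, degenerationIdeal]
  ext G
  rw [RingHom.mem_ker, RingHom.mem_ker, RingHom.comp_apply, map_eq_zero_iff j hj]

theorem exists_injective_to_field.{u} (A : Type u) [CommRing A] [IsDomain A] :
    ∃ (F : Type u) (_ : Field F) (j : A →+* F), Function.Injective j :=
  ⟨FractionRing A, inferInstance, algebraMap A _, IsFractionRing.injective A _⟩

/-- The total space is normal if the central fiber is reduced: normality holds where `X ≠ 0`, and
reducedness of the fiber over `X = 0` removes the remaining denominators. -/
theorem isIntegrallyClosed_chart_degenerationIdeal (hI : IsNormalProjectiveVariety I)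
    (hred : IsReducedSubscheme (fiberIdeal (degenerationIdeal b k I) 0)) (v : V)
    (hv : C (SymmetricAlgebra.ι ℂ V v) ∉ degenerationIdeal b k I) :
    IsIntegrallyClosed (AffineChart (degenerationIdeal b k I) (C (SymmetricAlgebra.ι ℂ V v))) := by
  have := hI.isPrime
  have : NoZeroDivisors (LaurentPolynomial (SymmetricAlgebra ℂ V ⧸ I)) := inferInstance
  have : IsDomain (LaurentPolynomial (SymmetricAlgebra ℂ V ⧸ I)) := NoZeroDivisors.to_isDomain _
  obtain ⟨F, _, j, hj⟩ := exists_injective_to_field (LaurentPolynomial (SymmetricAlgebra ℂ V ⧸ I))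
  let : Algebra ℂ F :=
    (j.comp (LaurentPolynomial.C.comp (algebraMap ℂ (SymmetricAlgebra ℂ V ⧸ I)))).toAlgebra
  set t := j (LaurentPolynomial.T 1) with ht_def
  set x : Fin n → F := fun i => j (LaurentPolynomial.C
    (Ideal.Quotient.mk I (SymmetricAlgebra.ι ℂ V (b i)))) with hx
  have hker : ∀ k, RingHom.ker (chartHom (twistedForm b x t k) t) = degenerationIdeal b k I :=
    fun k => ker_chartHom_twistedForm b k j hj fun c => rfl
  have ht : t ≠ 0 := ((LaurentPolynomial.isUnit_T 1).map j).ne_zero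
  set z := twistedForm b x t k with hz
  have hzv : z v ≠ 0 := by
    rwa [← hker k, RingHom.mem_ker, chartHom_C_ι] at hv
  set φ := chartHom (scaleForm (z v)⁻¹ z) t with hφ
  have hk : RingHom.ker φ =
      degenerationIdeal b k I ⊔ Ideal.span {C (SymmetricAlgebra.ι ℂ V v) - 1} :=
    ker_chartHom_scaleForm b z t (hker k) (degenerationIdeal_homogeneous b k hI.homogeneous) hzv
  have hfiber : (RingHom.ker φ).map (evalRingHom 0) =
      fiberIdeal (degenerationIdeal b k I) 0 ⊔ Ideal.span {SymmetricAlgebra.ι ℂ V v - 1} := by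
    rw [hk, Ideal.map_sup, Ideal.map_span, Set.image_singleton, fiberIdeal, map_zero]
    simp
  have hrad := isRadical_span_X φ (by rw [hfiber]; exact hred v)
  have hclosed : IsIntegrallyClosed φ.range := by
    rw [isIntegrallyClosed_subring_iff]
    intro y₁ hy₁ y₂ hy₂ hy₀ hy
    obtain ⟨M, hM⟩ := exists_pow_mul_mem_chart b k hI x ht (hker 0) hzv rfl hy₁ hy₂ hy₀ hy
    refine mem_of_pow_mul_mem_of_isIntegral (t := (⟨φ X, X, rfl⟩ : φ.range)) ?_ hrad hy M ?_
    · intro h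
      have := congrArg Subtype.val h
      exact ht ((chartHom_X _ _).symm.trans this)
    · have hXt : φ X = t := chartHom_X _ _
      change φ X ^ M * (y₁ / y₂) ∈ φ.range
      rwa [hXt]
  exact IsIntegrallyClosed.of_equiv
    ((Ideal.quotEquivOfEq hk.symm).trans (RingHom.quotientKerEquivRange φ)).symm

end NormalTotalSpace

/-! ### Real one-parameter subgroups -/

namespace RealOnePS

variable {V : Type*} [AddCommGroup V] [Module ℂ V] {n : ℕ}

theorem toLinearMap_eq_diagMap (σ : RealOnePS n V) (t : ℝ) :
    σ.toLinearMap t = diagMap σ.basis fun i => (Real.exp (-(σ.eigenvalue i) * t) : ℂ) := rfl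

theorem isEquivariant_iff (σ : RealOnePS n V) {G : Type*} [Group G] (ρ : Representation ℂ G V) :
    σ.IsEquivariant ρ ↔ ∀ g i j, σ.basis.repr (ρ g (σ.basis j)) i ≠ 0 →
      σ.eigenvalue i = σ.eigenvalue j := by
  constructor
  · intro h g i j hij
    have := (commute_diagMap_iff σ.basis _ (ρ g)).1 (h 1 g) i j hij
    simpa only [mul_one, neg_inj] using Real.exp_injective (Complex.ofReal_injective this)
  · intro h t g
    rw [toLinearMap_eq_diagMap, commute_diagMap_iff]
    intro i j hij
    rw [h g i j hij]

theorem centralFiber_eq_map (σ : RealOnePS n V) (I : Ideal (SymmetricAlgebra ℂ V)) :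
    σ.centralFiber I = (initialIdeal σ.eigenvalue (I.map (coordEquiv σ.basis))).map
      (coordEquiv σ.basis).symm := by
  rw [centralFiber, initialIdeal, Ideal.map_span]
  congr 1
  ext h
  constructor
  · rintro ⟨f, hf, rfl⟩
    exact ⟨_, ⟨_, Ideal.mem_map_of_mem _ hf, rfl⟩, rfl⟩
  · rintro ⟨_, ⟨g, hg, rfl⟩, rfl⟩
    refine ⟨(coordEquiv σ.basis).symm g, ?_, ?_⟩
    · rwa [← mem_map_coordEquiv σ.basis, AlgEquiv.apply_symm_apply]
    · rw [AlgEquiv.apply_symm_apply]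

theorem exists_int_multiple {τ : RealOnePS n V} (hτ : τ.HasRationalEigenvalues) :
    ∃ N : ℕ, 0 < N ∧ ∃ k : Fin n → ℤ, ∀ i, (k i : ℝ) = N * τ.eigenvalue i := by
  choose q hq using hτ
  refine ⟨∏ i, (q i).den, Finset.prod_pos fun i _ => (q i).den_pos, ?_⟩
  choose m hm using fun i => Finset.dvd_prod_of_mem (fun i => (q i).den) (Finset.mem_univ i)
  refine ⟨fun i => (q i).num * m i, fun i => ?_⟩
  have h1 : ((q i).den : ℝ) ≠ 0 := by exact_mod_cast (q i).den_ne_zero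
  rw [hm i, hq i]
  conv_rhs => rw [Rat.cast_def]
  push_cast
  field_simp

end RealOnePS

theorem initialForm_nat_mul {n : ℕ} (lam mu : Fin n → ℝ) {N : ℕ} (hN : 0 < N)
    (h : ∀ i, mu i = N * lam i) (f : MvPolynomial (Fin n) ℂ) :
    initialForm mu f = initialForm lam f := by
  refine initialForm_congr _ _ _ fun α _ β _ => ?_
  have hw : ∀ α : Fin n →₀ ℕ, Finsupp.weight mu α = N * Finsupp.weight lam α := fun α => by
    simp only [weight_eq_sum, h, Finset.mul_sum]
    exact Finset.sum_congr rfl fun i _ => by ring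
  rw [hw, hw]
  exact mul_le_mul_iff_right₀ (by exact_mod_cast hN)

end

theorem proposition2p8 {V : Type*} [AddCommGroup V] [Module ℂ V] {n : ℕ}
    (I : Ideal (SymmetricAlgebra ℂ V)) (hI : IsNormalProjectiveVariety I)
    {G : Type*} [Group G] (ρ : Representation ℂ G V) (hρ : PreservesSubscheme ρ I)
    (σ : RealOnePS n V) (hσ : σ.IsEquivariant ρ) :
    ∃ τ : ℕ → RealOnePS n V,
      (∀ i, (τ i).basis = σ.basis) ∧
      (∀ i, (τ i).HasRationalEigenvalues) ∧
      Tendsto (fun i => (τ i).eigenvalue) atTop (𝓝 σ.eigenvalue) ∧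
      (∀ i, (τ i).IsEquivariant ρ) ∧
      (∀ i, (τ i).centralFiber I = σ.centralFiber I) ∧
      ∀ i, ∃ N : ℕ, 0 < N ∧ ∃ D : CStarDegeneration I,
        D.IsGeneratedBy (τ i) N ∧ D.IsEquivariant ρ ∧
        D.centralFiber = σ.centralFiber I ∧
        (IsReducedSubscheme (σ.centralFiber I) → D.IsNormal) := by
  obtain ⟨tau, hrat, hlim, hrel, hini⟩ := exists_rational_weights σ.eigenvalue
    (I.map (coordEquiv σ.basis)) (homogeneousComponent_mem_map σ.basis hI.homogeneous)
  have hσ' := (σ.isEquivariant_iff ρ).1 hσ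
  have hfiber : ∀ l, (RealOnePS.mk σ.basis (tau l)).centralFiber I = σ.centralFiber I := fun l => by
    rw [RealOnePS.centralFiber_eq_map, RealOnePS.centralFiber_eq_map, hini l]
  have heq : ∀ l, (RealOnePS.mk σ.basis (tau l)).IsEquivariant ρ := fun l =>
    (RealOnePS.isEquivariant_iff _ ρ).2 fun g i j hij => hrel l i j (hσ' g i j hij)
  refine ⟨fun l => ⟨σ.basis, tau l⟩, fun _ => rfl, hrat, hlim, heq, hfiber, fun l => ?_⟩
  obtain ⟨N, hN, k, hk⟩ := RealOnePS.exists_int_multiple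
    (τ := RealOnePS.mk σ.basis (tau l)) (hrat l)
  have hkeq : ∀ g i j, σ.basis.repr (ρ g (σ.basis j)) i ≠ 0 → k i = k j := fun g i j hij => by
    have h : (k i : ℝ) = k j := by
      rw [hk, hk]
      exact congrArg _ (hrel l i j (hσ' g i j hij))
    exact_mod_cast h
  have hcentral : fiberIdeal (degenerationIdeal σ.basis k I) 0 = σ.centralFiber I := by
    rw [fiberIdeal_zero_degenerationIdeal, ← hfiber l]
    simp only [initialForm_nat_mul _ _ hN hk]
    rfl
  refine ⟨N, hN, diagDegeneration σ.basis k hI.homogeneous hI.isPrime, ?_, ⟨?_, ?_⟩, hcentral, ?_⟩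
  · intro t c hc
    change diagMap σ.basis _ = _
    rw [RealOnePS.toLinearMap_eq_diagMap]
    congr 1
    funext i
    rw [Units.val_zpow_eq_zpow_val, hc, ← Complex.ofReal_zpow, ← Real.rpow_intCast,
      ← Real.exp_mul, hk i]
    congr 2
    ring
  · exact fun g F hF => map_symMap_mem σ.basis k (ρ g) (hkeq g) (hρ g) hF
  · intro c g
    refine (commute_diagMap_iff σ.basis _ (ρ g)).2 fun i j hij => ?_
    rw [hkeq g i j hij]
  · intro hred v hv
    exact isIntegrallyClosed_chart_degenerationIdeal σ.basis k hI (hcentral ▸ hred) v hv
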